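/- **Proposition (bias of the multilevel double-loop QMC estimator with inexact sampling).** *Sampling.* Let $d_1,d_2\ge 1$, let $(u^{(n)})_{n\ge1}$ and $(t^{(m)})_{m\ge1}$ be Sobol' sequences in dimensions $d_1$ and $d_2$ (started at the origin). Let $L\ge1$, $N_\ell,M_\ell\ge1$ integers and $h_\ell>0$ (for example $M_\ell=M_02^\ell$, $h_\ell=h_02^{-\ell}$), and let $\tau^{(0)},\dots,\tau^{(L)}$ (dimension $d_1$) and $\rho$ (dimension $d_2$) be independent Owen scramblings (nested uniform scramblings in base $2$). Put $y^{(\ell,n)}=\tau^{(\ell)}(u^{(n)})$ and $x^{(m)}=\rho(t^{(m)})$. *Integrals and estimator.* For $g:[0,1]^{d_1}\times[0,1]^{d_2}\to\mathbb R$ and $f$ let $\bar g(y)=\int_{[0,1]^{d_2}}g(y,x)\,dx$ and $I=\int_{[0,1]^{d_1}}f(\bar g(y))\,dy$. With approximations $g_{h_\ell}$ of $g$ put $\varphi_\ell(y)=f\big(\frac1{M_\ell}\sum_{m=1}^{M_\ell}g_{h_\ell}(y,t^{(m)})\big)$ for $\ell<L$, $\varphi_L(y)=f\big(\frac1{M_L}\sum_{m=1}^{M_L}g_{h_L}(y,x^{(m)})\big)$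 and $$I_{\rm MLDLQ}=\frac1{N_0}\sum_{n=1}^{N_0}\varphi_0(y^{(0,n)})+\sum_{\ell=1}^{L}\frac1{N_\ell}\sum_{n=1}^{N_\ell}\big[\varphi_\ell(y^{(\ell,n)})-\varphi_{\ell-1}(y^{(\ell,n)})\big].$$ *Assumptions.* $f:\mathbb R\to\mathbb R$, $g$ and $g_{h_\ell}$ are measurable; $f$ is $C^3$ and $|f'''|$ is monotone (nondecreasing or nonincreasing) on an open set $U\subseteq\mathbb R$; $\bar g$ is everywhere positive or everywhere negative, and $K\bar g(y)\in U$ for all $y\in[0,1]^{d_1}$, $0<K<2$. The $\varphi_\ell(y)$, $0\le\ell\le L$, with $y$ uniform on $[0,1]^{d_1}$ and independent of $\rho$, are integrable. Moreover: 1. (Weak rate) $\big|\mathbb E\big[f(\tfrac1{M_L}\sum_{m=1}^{M_L}g_{h_L}(y,x^{(m)}))-f(\tfrac1{M_L}\sum_{m=1}^{M_L}g(y,x^{(m)}))\big]\big|\le C_{\rm w}h_L^{\eta_{\rm w}}$, where $C_{\rm w},\eta_{\rm w}>0$, $y$ is uniform on $[0,1]^{d_1}$ and independent of $\rho$, and the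 expectation exists. 2. (Sobolev) For some $1\le p\le\infty$, $f(K\bar g(\cdot))\in W^{3,p}([0,1]^{d_1})$ for all $0<K<2$. 3. (Inverse inequality) $\sup_{y}|V_{\rm HK}(g(y,\cdot))/\bar g(y)|<k<\infty$, where $V_{\rm HK}$ is the variation in the sense of Hardy and Krause (the sum of the Vitali variations on all faces of the cube through $(1,\dots,1)$), and $\bar g\in L^{3q}([0,1]^{d_1})$ with $1/p+1/q=1$. *Claim.* There are constants $C_{\epsilon,d_2}>0$ ($\epsilon>0$), depending only on $\epsilon$ and the Sobol' sequence $(t^{(m)})$, with $C_{\epsilon,d_2}\to\infty$ as $\epsilon\to0^+$, such that for every $\epsilon>0$ the star discrepancies satisfy, for all $M\ge1$, $D^*(t^{(1)},\dots,t^{(M)})\le C_{\epsilon,d_2}M^{-1+\epsilon}$ and, with probability one, $D^*(x^{(1)},\dots,x^{(M)})\le C_{\epsilon,d_2}M^{-1+\epsilon}$; and such that, under the assumptions above, for every $\epsilon>0$ with $kC_{\epsilon,d_2}M_L^{-1+\epsilon}<1$ there is a $K$ with $0<K<2$ and $$|\mathbb E[I_{\rm MLDLQ}]-I|\le C_{\rm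 w}h_L^{\eta_{\rm w}}+\frac{\mathbb E[|\bar g|^2|f''(\bar g)|]\,k^2C_{\epsilon,d_2}^2}{2M_L^{2-2\epsilon}}+\frac{\mathbb E[|\bar g|^3|f'''(K\bar g)|]\,k^3C_{\epsilon,d_2}^3}{6M_L^{3-3\epsilon}},$$ where the expectations on the right are over $y$ uniform on $[0,1]^{d_1}$ and take values in $[0,\infty]$. -/

import Mathlib

open MeasureTheory ProbabilityTheory Filter Topology
open scoped ENNReal

namespace MLDLQMC

noncomputable section

/-- The closed unit cube `[0,1]^d`. -/
def unitCube (d : ℕ) : Set (Fin d → ℝ) := Set.Icc 0 1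

/-- The open unit cube `(0,1)^d`. -/
def openCube (d : ℕ) : Set (Fin d → ℝ) := Set.univ.pi fun _ => Set.Ioo 0 1

/-! ### Star discrepancy and Hardy--Krause variation -/

/-- Star discrepancy of the first `M` points of `x`: the supremum over the anchored half-open
boxes `[0,s)`, `s ∈ [0,1]^d`, of the difference between the proportion of points in the box and
its volume. -/
def starDiscrepancy {d : ℕ} (M : ℕ) (x : ℕ → Fin d → ℝ) : ℝ :=
  ⨆ s : unitCube d,
    |(∑ m ∈ Finset.range M,
        (Set.univ.pi fun i => Set.Ico 0 (s.1 i)).indicator (fun _ => (1 : ℝ)) (x m)) / M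
      - ∏ i, s.1 i|

/-- Alternating sum of `φ` over the corners of the box `∏ i ∈ u, [a i, b i]`, the coordinates
outside `u` being frozen at `1`. -/
def boxDifference {d : ℕ} (φ : (Fin d → ℝ) → ℝ) (u : Finset (Fin d)) (a b : Fin d → ℝ) : ℝ :=
  ∑ v ∈ u.powerset,
    (-1) ^ v.card * φ (fun i => if i ∈ v then a i else if i ∈ u then b i else 1)

/-- Vitali variation of the restriction of `φ` to the face `{x | x i = 1 for i ∉ u}` of the unit
cube: the supremum over all product grids `p i 0 ≤ ... ≤ p i n` (`i ∈ u`) in `[0,1]` of the sum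
of the absolute alternating sums over the cells. -/
def vitaliVariation {d : ℕ} (φ : (Fin d → ℝ) → ℝ) (u : Finset (Fin d)) : ℝ≥0∞ :=
  ⨆ (n : ℕ) (p : {p : Fin d → ℕ → ℝ // ∀ i, Monotone (p i) ∧ ∀ j, p i j ∈ Set.Icc (0 : ℝ) 1}),
    ∑ c ∈ Fintype.piFinset fun i => if i ∈ u then Finset.range n else {0},
      ENNReal.ofReal |boxDifference φ u (fun i => p.1 i (c i)) (fun i => p.1 i (c i + 1))|

/-- Variation in the sense of Hardy and Krause (anchored at `1`): the sum of the Vitali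
variations over all faces `{x | x i = 1 for i ∉ u}`, `u` nonempty. -/
def hardyKrause {d : ℕ} (φ : (Fin d → ℝ) → ℝ) : ℝ≥0∞ :=
  ∑ u ∈ (Finset.univ : Finset (Fin d)).powerset.erase ∅, vitaliVariation φ u

/-! ### Sobolev spaces on the unit cube -/

/-- `u ∈ W^{n,p}((0,1)^d)`: `u ∈ L^p`, and every partial derivative of order `m ≤ n` (in the
coordinate directions `β 0, …, β (m-1)`) exists weakly and is in `L^p`. -/
def MemSobolev {d : ℕ} (n : ℕ) (p : ℝ≥0∞) (u : (Fin d → ℝ) → ℝ) : Prop :=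
  MemLp u p (volume.restrict (openCube d)) ∧
  ∀ m ≤ n, ∀ β : Fin m → Fin d, ∃ v : (Fin d → ℝ) → ℝ,
    MemLp v p (volume.restrict (openCube d)) ∧
    ∀ φ : (Fin d → ℝ) → ℝ, ContDiff ℝ ((⊤ : ℕ∞) : WithTop ℕ∞) φ → HasCompactSupport φ → tsupport φ ⊆ openCube d →
      ∫ x in openCube d, u x * iteratedFDeriv ℝ m φ x (fun i => Pi.single (β i) 1)
        = (-1) ^ m * ∫ x in openCube d, v x * φ x

/-! ### The Sobol' sequence -/

/-- A primitive polynomial over `𝔽₂`: an irreducible polynomial of degree `s` whose root generates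
the multiplicative group of `𝔽_{2^s}`. -/
def IsPrimitivePoly (P : Polynomial (ZMod 2)) : Prop :=
  Irreducible P ∧ orderOf (AdjoinRoot.root P) = 2 ^ P.natDegree - 1

/-- A `d`-dimensional Sobol' sequence, given by its primitive polynomials and direction numbers.
`V j k b` is the binary digit of weight `2^{-(b+1)}` of the `(k+1)`-st direction number of
coordinate `j`. The first coordinate is the van der Corput sequence. The other coordinates use
pairwise distinct primitive polynomials `x^s + a₁ x^{s-1} + ⋯ + a_{s-1} x + 1`, with the recursion
`v_k = a₁ v_{k-1} ⊕ ⋯ ⊕ a_{s-1} v_{k-s+1} ⊕ v_{k-s} ⊕ 2^{-s} v_{k-s}` for `k > s`; the initial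
direction numbers `v_k = m_k / 2^k`, `k ≤ s`, with `m_k < 2^k` odd, are arbitrary. -/
structure SobolSequence (d : ℕ) where
  poly : Fin d → Polynomial (ZMod 2)
  V : Fin d → ℕ → ℕ → ZMod 2
  first : ∀ j : Fin d, (j : ℕ) = 0 → ∀ k b, V j k b = if b = k then 1 else 0
  primitive : ∀ j : Fin d, (j : ℕ) ≠ 0 → IsPrimitivePoly (poly j)
  distinct : ∀ i j : Fin d, (i : ℕ) ≠ 0 → (j : ℕ) ≠ 0 → poly i = poly j → i = j
  diag : ∀ j k, V j k k = 1
  upper : ∀ j k b, k < b → V j k b = 0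
  recursion : ∀ j : Fin d, (j : ℕ) ≠ 0 → ∀ k b, (poly j).natDegree ≤ k →
    V j k b =
      (∑ i ∈ Finset.range (poly j).natDegree,
        (poly j).coeff ((poly j).natDegree - 1 - i) * V j (k - 1 - i) b)
      + if (poly j).natDegree ≤ b then
          V j (k - (poly j).natDegree) (b - (poly j).natDegree) else 0

/-- The binary digits of the `n`-th point (`n ≥ 0`): the sum in `𝔽₂` of the direction numbers
selected by the binary digits of `n`. -/
def SobolSequence.digits {d : ℕ} (S : SobolSequence d) (n : ℕ) (j : Fin d) (b : ℕ) : ZMod 2 :=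
  ∑ k ∈ Finset.range n, if n.testBit k then S.V j k b else 0

/-- The point of `[0,1]^d` with the given binary digits. -/
def ofDigits {d : ℕ} (a : Fin d → ℕ → ZMod 2) : Fin d → ℝ :=
  fun j => ∑' b : ℕ, ((a j b).val : ℝ) / 2 ^ (b + 1)

/-- The `n`-th point of the Sobol' sequence, counted from `0`. -/
def SobolSequence.point {d : ℕ} (S : SobolSequence d) (n : ℕ) : Fin d → ℝ :=
  ofDigits (S.digits n)

/-! ### Owen's scrambling -/

/-- Index set of the digit permutations in base `2` of a nested scrambling: one for each coordinate
and each finite string of preceding digits. -/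
abbrev ScrambleIndex (d : ℕ) := Fin d × List (ZMod 2)

/-- Nested scrambling of digits in base `2`: digit `b` is permuted (shifted by an element of
`ZMod 2`) by the permutation attached to the preceding digits. -/
def scramble {d : ℕ} (π : ScrambleIndex d → ZMod 2) (a : Fin d → ℕ → ZMod 2) :
    Fin d → ℕ → ZMod 2 :=
  fun j b => a j b + π (j, (List.range b).map (a j))

/-- The `n`-th scrambled Sobol' point. -/
def SobolSequence.scrambledPoint {d : ℕ} (S : SobolSequence d) (π : ScrambleIndex d → ZMod 2)
    (n : ℕ) : Fin d → ℝ :=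
  ofDigits (scramble π (S.digits n))

/-- `ξ` is a family of independent, uniformly distributed random elements of `ZMod 2`, that is, of
uniformly random permutations of the digits `0, 1`. -/
def IsUniformBits {ι Ω : Type*} [MeasurableSpace Ω] (P : Measure Ω) (ξ : ι → Ω → ZMod 2) : Prop :=
  (∀ i, Measurable (ξ i)) ∧ (∀ i a, P {ω | ξ i ω = a} = 1 / 2) ∧ iIndepFun ξ P

/-! ### Nested integrals and the estimator -/

/-- The inner integral `ḡ(y) = ∫_{[0,1]^{d₂}} g(y,x) dx`. -/
def innerIntegral {d₁ d₂ : ℕ} (g : (Fin d₁ → ℝ) → (Fin d₂ → ℝ) → ℝ) (y : Fin d₁ → ℝ) : ℝ :=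
  ∫ x in unitCube d₂, g y x

/-- The nested integral `I = ∫_{[0,1]^{d₁}} f(ḡ(y)) dy`. -/
def nestedIntegral {d₁ d₂ : ℕ} (f : ℝ → ℝ) (g : (Fin d₁ → ℝ) → (Fin d₂ → ℝ) → ℝ) : ℝ :=
  ∫ y in unitCube d₁, f (innerIntegral g y)

/-- The sample mean of `φ` over the first `N` points of `z`. -/
def mean {E : Type*} (N : ℕ) (φ : E → ℝ) (z : ℕ → E) : ℝ :=
  (∑ n ∈ Finset.range N, φ (z n)) / N

/-- The multilevel double-loop estimator with one randomization and levels `0, …, L` (`L ≥ 1`):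
`N ℓ` outer points `y ℓ` and `M ℓ` inner points at level `ℓ`, discretization parameter `h ℓ`; the
inner points are `t` below level `L` and `x` for the fine term at level `L`. -/
def mldlEstimator {d₁ d₂ : ℕ} (f : ℝ → ℝ) (gh : ℝ → (Fin d₁ → ℝ) → (Fin d₂ → ℝ) → ℝ)
    (L : ℕ) (N M : ℕ → ℕ) (h : ℕ → ℝ)
    (y : ℕ → ℕ → Fin d₁ → ℝ) (t x : ℕ → Fin d₂ → ℝ) : ℝ :=
  mean (N 0) (fun y => f (mean (M 0) (gh (h 0) y) t)) (y 0)
  + ∑ ℓ ∈ Finset.Ico 1 L,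
      mean (N ℓ) (fun y => f (mean (M ℓ) (gh (h ℓ) y) t)
        - f (mean (M (ℓ - 1)) (gh (h (ℓ - 1)) y) t)) (y ℓ)
  + mean (N L) (fun y => f (mean (M L) (gh (h L) y) x)
        - f (mean (M (L - 1)) (gh (h (L - 1)) y) t)) (y L)

/-- Weak rate of the approximation `gh` of `g`, with `M` random inner points `X 0, …, X (M-1)` and
discretization parameter `h`: the expected difference
`E[f(M⁻¹ ∑ gh(y, X m)) - f(M⁻¹ ∑ g(y, X m))]`, where `y` is uniform on `[0,1]^{d₁}` and independent
of the points `X m`, exists and is at most `C * h ^ η` in absolute value. -/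
def HasWeakRate {d₁ d₂ : ℕ} {Ω : Type*} [MeasurableSpace Ω] (P : Measure Ω) (f : ℝ → ℝ)
    (g gh : (Fin d₁ → ℝ) → (Fin d₂ → ℝ) → ℝ) (M : ℕ) (X : Ω → ℕ → Fin d₂ → ℝ)
    (h C η : ℝ) : Prop :=
  Integrable (fun z : (Fin d₁ → ℝ) × Ω => f (mean M (gh z.1) (X z.2)) - f (mean M (g z.1) (X z.2)))
    ((volume.restrict (unitCube d₁)).prod P) ∧
  |∫ z : (Fin d₁ → ℝ) × Ω, (f (mean M (gh z.1) (X z.2)) - f (mean M (g z.1) (X z.2)))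
    ∂((volume.restrict (unitCube d₁)).prod P)| ≤ C * h ^ η

/-- The moment `E[|ḡ|^n |f⁽ⁿ⁾(K ḡ)|] ∈ [0,∞]` of the inner integral, with `y` uniform on
`[0,1]^{d₁}`. -/
def derivMoment {d₁ d₂ : ℕ} (f : ℝ → ℝ) (g : (Fin d₁ → ℝ) → (Fin d₂ → ℝ) → ℝ) (n : ℕ) (K : ℝ) :
    ℝ≥0∞ :=
  ∫⁻ y in unitCube d₁,
    ENNReal.ofReal (|innerIntegral g y| ^ n * |iteratedDeriv n f (K * innerIntegral g y)|)

end

end MLDLQMC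

open MLDLQMC

/-!
The proof has two parts: the points of every scrambling of a Sobol' sequence have discrepancy
`O(M⁻¹ (log M) ^ (d + 1))`, and the bias of the estimator is controlled by a third-order Taylor
expansion of `f` around `ḡ(y)`.

*Discrepancy.* Read as sequences in the column index, the rows of the generating matrix of
coordinate `j` satisfy `p_j(E) w_b = w_{b - deg p_j}`, where `E` is the shift. Hence the first
`q * deg p_j` rows lie in `ker p_j(E) ^ q`. The polynomials are pairwise coprime and monic, so a
linear relation between rows that holds in sufficiently many columns is trivial
(`SobolSequence.coeff_eq_zero_of_truncated_relation`). This gives equidistribution in elementary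
intervals up to an error of `2 ^ t` on each aligned block of indices, with `t = ∑ deg p_j`. A nested
scrambling permutes the elementary intervals of each shape, so the same holds for every scrambling.
An anchored box is, up to a thin shell, a union of few elementary intervals
(`abs_measureReal_box_sub_le`). Applied to the counting measure on the first `M` indices this bounds
the discrepancy, and applied to the random bits it shows that a scrambled point is uniformly
distributed.

*Integration error.* The Koksma--Hlawka inequality is proved for two finite point sets, by
summation by parts on a common grid (`abs_mean_sub_mean_le`). As the integral of `φ` is the
expectation of its mean over a randomly scrambled point set, averaging over that second set
bounds the error of the first one by twice the discrepancy bound times the variation. The factor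
`2` is absorbed into the constants.

*Bias.* Scrambled points are uniform and the scramblings are independent, so in expectation the sum
over the levels telescopes to the finest level (`integral_mldlEstimator`). The weak rate replaces
`g_h` by `g` there. For fixed `y` the mean of `g(y, ·)` over the scrambled points is an unbiased
estimator of `ḡ(y)` with relative error at most `θ = k C_ε M_L ^ (-1 + ε) < 1`. The first-order Taylor
term therefore has expectation zero, the second-order term gives the second moment, and
monotonicity of `|f'''|` together with the constant sign of `ḡ` bounds the remainder by
`|f'''(K ḡ(y))|` with `K = 1 + θ` or `K = 1 - θ`, uniformly in `y`.
-/

namespace MLDLQMC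

/-! ### Linear independence of the rows of the generating matrices -/

/-- The shift operator `(E w) k = w (k + 1)` on sequences. -/
def seqShift (K : Type*) [Field K] : Module.End K (ℕ → K) := LinearMap.funLeft K K Nat.succ

lemma seqShift_pow_apply {K : Type*} [Field K] (i : ℕ) (w : ℕ → K) (k : ℕ) :
    ((seqShift K) ^ i) w k = w (k + i) := by
  induction i generalizing k with
  | zero => simp
  | succ i ih =>
    rw [pow_succ', Module.End.mul_apply]
    simp only [seqShift, LinearMap.funLeft_apply] at ih ⊢
    rw [ih]
    congr 1
    omega

lemma aeval_seqShift_apply {K : Type*} [Field K] (p : Polynomial K) (w : ℕ → K) (k : ℕ) :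
    (Polynomial.aeval (seqShift K) p) w k
      = ∑ i ∈ Finset.range (p.natDegree + 1), p.coeff i * w (k + i) := by
  rw [Polynomial.aeval_eq_sum_range]
  simp [LinearMap.sum_apply, Finset.sum_apply, seqShift_pow_apply]

/-- A solution of a linear recurrence of order at most `m` vanishes if its first `m` terms do. -/
lemma eq_zero_of_aeval_seqShift_eq_zero {K : Type*} [Field K] {p : Polynomial K} (hp : p.Monic)
    {w : ℕ → K} (hw : Polynomial.aeval (seqShift K) p w = 0) {m : ℕ} (hm : p.natDegree ≤ m)
    (h0 : ∀ k < m, w k = 0) : w = 0 := by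
  funext k
  induction k using Nat.strong_induction_on with
  | _ k ih =>
    rcases lt_or_ge k m with hk | hk
    · exact h0 k hk
    · have h := congrFun hw (k - p.natDegree)
      rw [aeval_seqShift_apply, Finset.sum_range_succ, Finset.sum_eq_zero, hp.coeff_natDegree] at h
      · rw [Nat.sub_add_cancel (by omega)] at h
        simpa using h
      · intro i hi
        rw [Finset.mem_range] at hi
        rw [ih (k - p.natDegree + i) (by omega)]
        simp

lemma IsPrimitivePoly.ne_X {P : Polynomial (ZMod 2)} (hP : IsPrimitivePoly P) :
    P ≠ Polynomial.X := by
  rintro rfl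
  have : Fact (Irreducible (Polynomial.X : Polynomial (ZMod 2))) := ⟨hP.1⟩
  have h := hP.2
  rw [Polynomial.natDegree_X] at h
  have h1 : orderOf (AdjoinRoot.root (Polynomial.X : Polynomial (ZMod 2))) = 1 := by simpa using h
  rw [orderOf_eq_one_iff, AdjoinRoot.root, AdjoinRoot.mk_self] at h1
  exact zero_ne_one h1

namespace SobolSequence

variable {d : ℕ} (S : SobolSequence d)

/-- The polynomial governing coordinate `j`. The van der Corput coordinate obeys the recursion of
the other coordinates with the polynomial `X`. -/
noncomputable def recPoly (j : Fin d) : Polynomial (ZMod 2) :=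
  if (j : ℕ) = 0 then Polynomial.X else S.poly j

lemma irreducible_recPoly (j : Fin d) : Irreducible (S.recPoly j) := by
  unfold recPoly
  split_ifs with h
  · exact Polynomial.irreducible_X
  · exact (S.primitive j h).1

lemma monic_recPoly (j : Fin d) : (S.recPoly j).Monic := by
  have h := Polynomial.leadingCoeff_ne_zero.2 (S.irreducible_recPoly j).ne_zero
  have h2 : ∀ a : ZMod 2, a ≠ 0 → a = 1 := by decide
  exact h2 _ h

lemma natDegree_recPoly_pos (j : Fin d) : 0 < (S.recPoly j).natDegree :=
  (S.irreducible_recPoly j).natDegree_pos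

lemma recPoly_injective : Function.Injective S.recPoly := by
  intro i j hij
  unfold recPoly at hij
  split_ifs at hij with h1 h2 h2
  · exact Fin.ext (h1.trans h2.symm)
  · exact absurd hij.symm ((S.primitive j h2).ne_X)
  · exact absurd hij ((S.primitive i h1).ne_X)
  · exact S.distinct i j h1 h2 hij

lemma isCoprime_recPoly {i j : Fin d} (hij : i ≠ j) : IsCoprime (S.recPoly i) (S.recPoly j) := by
  rw [(S.irreducible_recPoly i).coprime_iff_not_dvd]
  intro h
  have := (S.irreducible_recPoly i).associated_of_dvd (S.irreducible_recPoly j) h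
  exact hij (S.recPoly_injective
    (Polynomial.eq_of_monic_of_associated (S.monic_recPoly i) (S.monic_recPoly j) this))

/-- Row `b` of the generating matrix of coordinate `j`, as an infinite sequence. -/
def row (j : Fin d) (b : ℕ) : ℕ → ZMod 2 := fun k => S.V j k b

/-- The recursion of the direction numbers says that the polynomial of coordinate `j`, applied to
the shift, lowers the index of a row by its degree. -/
lemma aeval_recPoly_row (j : Fin d) (b : ℕ) :
    Polynomial.aeval (seqShift (ZMod 2)) (S.recPoly j) (S.row j b)
      = if (S.recPoly j).natDegree ≤ b then S.row j (b - (S.recPoly j).natDegree) else 0 := by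
  funext k
  rw [aeval_seqShift_apply]
  by_cases hj : (j : ℕ) = 0
  · simp only [recPoly, hj, if_true, Polynomial.natDegree_X, Finset.sum_range_succ, row,
      S.first j hj, Polynomial.coeff_X]
    rcases b with _ | b
    · simp
    · simp [row, S.first j hj]
  · have hp : S.recPoly j = S.poly j := by simp [recPoly, hj]
    rw [hp]
    set e := (S.poly j).natDegree with he
    have hrec := S.recursion j hj (k + e) b (by omega)
    rw [← he] at hrec
    have hlead : (S.poly j).coeff e = 1 := by
      have := S.monic_recPoly j
      rw [hp] at this
      exact this.coeff_natDegree
    rw [Finset.sum_range_succ, hlead, one_mul, ← Finset.sum_range_reflect]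
    simp only [row]
    rw [hrec]
    have hs : ∑ i ∈ Finset.range e, (S.poly j).coeff (e - 1 - i) * S.V j (k + (e - 1 - i)) b
        = ∑ i ∈ Finset.range e, (S.poly j).coeff (e - 1 - i) * S.V j (k + e - 1 - i) b := by
      refine Finset.sum_congr rfl fun i hi => ?_
      rw [Finset.mem_range] at hi
      rw [show k + (e - 1 - i) = k + e - 1 - i by omega]
    rw [hs, ← add_assoc, CharTwo.add_self_eq_zero, zero_add, Nat.add_sub_cancel]
    split_ifs <;> rfl

lemma aeval_recPoly_pow_row (j : Fin d) (q b : ℕ) (hb : b < q * (S.recPoly j).natDegree) :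
    Polynomial.aeval (seqShift (ZMod 2)) (S.recPoly j ^ q) (S.row j b) = 0 := by
  induction q generalizing b with
  | zero => simp at hb
  | succ q ih =>
    rw [pow_succ, map_mul, Module.End.mul_apply, aeval_recPoly_row]
    split_ifs with h
    · apply ih
      rw [add_mul] at hb
      omega
    · simp

/-- The matrix of coordinate `j` is triangular with ones on the diagonal. -/
lemma eq_zero_of_sum_row_eq_zero (j : Fin d) (l : ℕ) (c : ℕ → ZMod 2)
    (h : ∑ b ∈ Finset.range l, c b • S.row j b = 0) : ∀ b < l, c b = 0 := by
  intro b
  induction b using Nat.strong_induction_on with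
  | _ b ih =>
    intro hb
    have hk := congrFun h b
    rw [Finset.sum_apply, Finset.sum_eq_single b] at hk
    · simpa [row, S.diag] using hk
    · intro b' hb' hne
      rw [Finset.mem_range] at hb'
      rcases lt_or_gt_of_ne hne with hlt | hgt
      · simp [ih b' hlt hb']
      · simp [row, S.upper j b b' hgt]
    · intro hn
      exact absurd (Finset.mem_range.2 hb) hn

/-- The sum of the degrees of the polynomials of a Sobol' sequence, an upper bound for its quality
parameter `t`. -/
noncomputable def degreeSum : ℕ := ∑ j, (S.recPoly j).natDegree

/-- The first `l j` rows of all coordinates, truncated to `m` columns, are linearly independent if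
`∑ l j + ∑ deg p j ≤ m`. The relation is a recurrence solution for `∏ p j ^ q j`; it vanishes
identically because its first terms do, and the kernels of the coprime factors are independent. -/
lemma coeff_eq_zero_of_truncated_relation (l : Fin d → ℕ) (m : ℕ)
    (hm : ∑ j, l j + S.degreeSum ≤ m) (c : Fin d → ℕ → ZMod 2)
    (h : ∀ k < m, ∑ j, ∑ b ∈ Finset.range (l j), c j b * S.V j k b = 0) :
    ∀ j, ∀ b < l j, c j b = 0 := by
  let e : Fin d → ℕ := fun j => (S.recPoly j).natDegree
  -- round `l j` up to a multiple of the degree, so that the rows involved fill a full kernel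
  have he : ∀ j, 0 < e j := S.natDegree_recPoly_pos
  let q : Fin d → ℕ := fun j => l j / e j + 1
  have hq1 : ∀ j, l j < q j * e j := fun j => by
    have := Nat.lt_div_mul_add (a := l j) (he j)
    simp only [q, add_mul, one_mul]
    exact this
  have hq2 : ∀ j, q j * e j ≤ l j + e j := fun j => by
    have := Nat.div_mul_le_self (l j) (e j)
    simp only [q, add_mul, one_mul]
    omega
  let A := Polynomial.aeval (R := ZMod 2) (seqShift (ZMod 2))
  let Q : Fin d → Polynomial (ZMod 2) := fun j => S.recPoly j ^ q j
  let s : Fin d → ℕ → ZMod 2 := fun j => ∑ b ∈ Finset.range (l j), c j b • S.row j b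
  have hQs : ∀ j, A (Q j) (s j) = 0 := by
    intro j
    simp only [s, map_sum, map_smul]
    refine Finset.sum_eq_zero fun b hb => ?_
    rw [Finset.mem_range] at hb
    rw [S.aeval_recPoly_pow_row j (q j) b (lt_trans hb (hq1 j)), smul_zero]
  have hkill : ∀ (T : Finset (Fin d)) (j : Fin d), j ∈ T → A (∏ i ∈ T, Q i) (s j) = 0 := by
    intro T j hj
    rw [← Finset.prod_erase_mul _ _ hj, map_mul, Module.End.mul_apply, hQs, map_zero]
  have hsum : ∑ j, s j = 0 := by
    refine eq_zero_of_aeval_seqShift_eq_zero (p := ∏ j, Q j) (m := m) ?_ ?_ ?_ ?_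
    · exact Polynomial.monic_prod_of_monic _ _ fun j _ => (S.monic_recPoly j).pow _
    · rw [map_sum]
      exact Finset.sum_eq_zero fun j hj => hkill _ j hj
    · rw [Polynomial.natDegree_prod_of_monic _ _ fun j _ => (S.monic_recPoly j).pow _]
      refine le_trans ?_ hm
      rw [degreeSum, ← Finset.sum_add_distrib]
      refine Finset.sum_le_sum fun j _ => ?_
      rw [(S.monic_recPoly j).natDegree_pow]
      exact hq2 j
    · intro k hk
      rw [← h k hk]
      simp [s, Finset.sum_apply, row]
  intro j
  refine S.eq_zero_of_sum_row_eq_zero j (l j) (c j) ?_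
  change s j = 0
  have hcop : IsCoprime (Q j) (∏ i ∈ Finset.univ.erase j, Q i) :=
    IsCoprime.prod_right fun i hi => (S.isCoprime_recPoly (Finset.ne_of_mem_erase hi).symm).pow
  have hsj : s j = -∑ i ∈ Finset.univ.erase j, s i := by
    rw [← Finset.add_sum_erase _ _ (Finset.mem_univ j)] at hsum
    exact eq_neg_of_add_eq_zero_left hsum
  have h2 : A (∏ i ∈ Finset.univ.erase j, Q i) (s j) = 0 := by
    rw [hsj, map_neg, map_sum, Finset.sum_eq_zero fun i hi => hkill _ i hi, neg_zero]
  have hd := Polynomial.disjoint_ker_aeval_of_isCoprime (seqShift (ZMod 2)) hcop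
  exact (Submodule.disjoint_def.1 hd) _ (LinearMap.mem_ker.2 (hQs j)) (LinearMap.mem_ker.2 h2)

end SobolSequence

/-! ### Equidistribution of (scrambled) Sobol' points in elementary intervals -/

/-- The digit array `a` lies in the elementary interval fixed by the first `l j` digits of `z j`,
`j : Fin d`. -/
def InCell {d : ℕ} (l : Fin d → ℕ) (z a : Fin d → ℕ → ZMod 2) : Prop :=
  ∀ j, ∀ b < l j, a j b = z j b

lemma InCell.mono {d : ℕ} {l l' : Fin d → ℕ} {z a : Fin d → ℕ → ZMod 2} (h : InCell l z a)
    (hl : ∀ j, l' j ≤ l j) : InCell l' z a :=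
  fun j b hb => h j b (hb.trans_le (hl j))

/-- Scrambling maps elementary intervals bijectively to elementary intervals of the same shape. -/
lemma exists_inCell_scramble_iff {d : ℕ} (π : ScrambleIndex d → ZMod 2)
    (z : Fin d → ℕ → ZMod 2) :
    ∃ z' : Fin d → ℕ → ZMod 2, ∀ l a, InCell l z (scramble π a) ↔ InCell l z' a := by
  -- `pre j b` is the string of the first `b` digits of the array that is scrambled to `z`
  let pre : Fin d → ℕ → List (ZMod 2) := fun j b =>
    Nat.rec [] (fun b L => L ++ [z j b - π (j, L)]) b
  refine ⟨fun j b => z j b - π (j, pre j b), fun l a => forall_congr' fun j => ?_⟩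
  have hpre : ∀ n, (∀ b < n, a j b = z j b - π (j, pre j b)) →
      (List.range n).map (a j) = pre j n := by
    intro n
    induction n with
    | zero => simp [pre]
    | succ n ih =>
      intro h
      rw [List.range_succ, List.map_append, ih fun b hb => h b (by omega), List.map_singleton,
        h n (by omega)]
  suffices H : ∀ n, (∀ b < n, scramble π a j b = z j b) ↔
      ∀ b < n, a j b = z j b - π (j, pre j b) from H (l j)
  intro n
  induction n with
  | zero => simp
  | succ n ih =>
    rw [Nat.forall_lt_succ_right, Nat.forall_lt_succ_right, ih]
    refine and_congr_right fun h => ?_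
    rw [scramble, hpre n h, eq_sub_iff_add_eq]

lemma exists_le_sum_eq {ι : Type*} (s : Finset ι) (l : ι → ℕ) (n : ℕ)
    (hn : n ≤ ∑ i ∈ s, l i) : ∃ l' : ι → ℕ, (∀ i, l' i ≤ l i) ∧ ∑ i ∈ s, l' i = n := by
  classical
  induction s using Finset.induction_on generalizing n with
  | empty => exact ⟨0, fun _ => Nat.zero_le _, by simp at hn; simp [hn]⟩
  | insert i s hi ih =>
    rw [Finset.sum_insert hi] at hn
    obtain ⟨l', h1, h2⟩ := ih (n - min n (l i)) (by omega)
    refine ⟨Function.update l' i (min n (l i)), fun k => ?_, ?_⟩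
    · rcases eq_or_ne k i with rfl | hk
      · simp
      · simpa [hk] using h1 k
    · rw [Finset.sum_insert hi, Finset.sum_update_of_notMem hi, h2, Function.update_self]
      omega

namespace SobolSequence

variable {d : ℕ} (S : SobolSequence d)

lemma digits_eq_sum_range {n K : ℕ} (hn : n < 2 ^ K) (j : Fin d) (b : ℕ) :
    S.digits n j b = ∑ k ∈ Finset.range K, if n.testBit k then S.V j k b else 0 := by
  have key : ∀ A B : ℕ, n < 2 ^ A → A ≤ B →
      ∑ k ∈ Finset.range A, (if n.testBit k then S.V j k b else 0)
        = ∑ k ∈ Finset.range B, if n.testBit k then S.V j k b else 0 := by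
    intro A B hA hAB
    refine Finset.sum_subset (Finset.range_subset_range.2 hAB) fun k _ hk => ?_
    rw [Finset.mem_range, not_lt] at hk
    rw [Nat.testBit_lt_two_pow (lt_of_lt_of_le hA (Nat.pow_le_pow_right two_pos hk))]
    simp
  rw [digits, key n (max n K) Nat.lt_two_pow_self (le_max_left _ _),
    key K (max n K) hn (le_max_right _ _)]

lemma digits_two_pow_mul_add (a m : ℕ) {n : ℕ} (hn : n < 2 ^ m) (j : Fin d) (b : ℕ) :
    S.digits (2 ^ m * a + n) j b = S.digits (2 ^ m * a) j b
      + ∑ k : Fin m, S.V j k b * (if n.testBit k then 1 else 0) := by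
  have hK : 2 ^ m * a + n < 2 ^ (m + a) := by
    calc 2 ^ m * a + n < 2 ^ m * (a + 1) := by rw [mul_add]; omega
      _ ≤ 2 ^ m * 2 ^ a := Nat.mul_le_mul_left _ Nat.lt_two_pow_self
      _ = 2 ^ (m + a) := (pow_add _ _ _).symm
  rw [S.digits_eq_sum_range hK, S.digits_eq_sum_range (lt_of_le_of_lt (Nat.le_add_right _ n) hK),
    Finset.sum_range_add, Finset.sum_range_add]
  have h1 : ∀ k ∈ Finset.range m,
      (if (2 ^ m * a).testBit k then S.V j k b else 0) = 0 := fun k hk => by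
    have := Nat.testBit_two_pow_mul_add a (b := 0) (Nat.two_pow_pos m) k
    rw [add_zero, if_pos (Finset.mem_range.1 hk)] at this
    simp [this]
  rw [Finset.sum_eq_zero h1, zero_add, add_comm (∑ _ ∈ Finset.range m, _)]
  refine congrArg₂ (· + ·) (Finset.sum_congr rfl fun k _ => ?_) ?_
  · have := Nat.testBit_two_pow_mul_add a (b := 0) (Nat.two_pow_pos m) (m + k)
    rw [add_zero] at this
    rw [Nat.testBit_two_pow_mul_add a hn, this]
    simp
  · rw [Finset.sum_range]
    refine Finset.sum_congr rfl fun k _ => ?_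
    rw [Nat.testBit_two_pow_mul_add a hn k, if_pos k.2]
    simp

/-- The map from column selections to digits, restricted to the first `l j` digits and `m`
columns, is onto. -/
lemma surjective_truncated_matrix (l : Fin d → ℕ) (m : ℕ) (hm : ∑ j, l j + S.degreeSum ≤ m) :
    Function.Surjective (Matrix.mulVecLin
      (Matrix.of fun (r : Σ j, Fin (l j)) (k : Fin m) => S.V r.1 k r.2)) := by
  set A : Matrix (Σ j, Fin (l j)) (Fin m) (ZMod 2) := Matrix.of fun r k => S.V r.1 k r.2 with hA
  have hli : LinearIndependent (ZMod 2) A.row := by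
    rw [Fintype.linearIndependent_iff]
    intro g hg r
    have h := S.coeff_eq_zero_of_truncated_relation l m hm
      (fun j b => if hb : b < l j then g ⟨j, ⟨b, hb⟩⟩ else 0) ?_ r.1 r.2 r.2.2
    · simpa using h
    · intro k hk
      have h := congrFun hg ⟨k, hk⟩
      rw [Finset.sum_apply, Fintype.sum_sigma] at h
      rw [Pi.zero_apply] at h
      rw [← h]
      refine Finset.sum_congr rfl fun j _ => ?_
      rw [Finset.sum_range]
      refine Finset.sum_congr rfl fun b _ => ?_
      simp [hA]
  rw [← LinearMap.range_eq_top]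
  apply Submodule.eq_top_of_finrank_eq
  rw [Module.finrank_fintype_fun_eq_card]
  exact hli.rank_matrix

open scoped Classical in
/-- Exact equidistribution: the Sobol' sequence is a digital `(t, d)`-sequence. -/
lemma card_inCell_digits_eq (l : Fin d → ℕ) (m : ℕ) (hm : ∑ j, l j + S.degreeSum ≤ m) (a : ℕ)
    (z : Fin d → ℕ → ZMod 2) :
    ((Finset.range (2 ^ m)).filter fun n => InCell l z (S.digits (2 ^ m * a + n))).card
      * 2 ^ (∑ j, l j) = 2 ^ m := by
  let F := Matrix.mulVecLin
      (Matrix.of fun (r : Σ j, Fin (l j)) (k : Fin m) => S.V r.1 k r.2)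
  have hF : Function.Surjective F := S.surjective_truncated_matrix l m hm
  let bits : Fin (2 ^ m) → Fin m → ZMod 2 := fun n k => if (n : ℕ).testBit k then 1 else 0
  have hbits : Function.Bijective bits := by
    rw [Fintype.bijective_iff_injective_and_card]
    refine ⟨fun n n' h => Fin.ext (Nat.eq_of_testBit_eq fun k => ?_), by simp [ZMod.card]⟩
    rcases lt_or_ge k m with hk | hk
    · have := congrFun h ⟨k, hk⟩
      simp only [bits] at this
      by_cases h1 : (n : ℕ).testBit k <;> by_cases h2 : (n' : ℕ).testBit k <;> simp_all
    · rw [Nat.testBit_lt_two_pow (n.2.trans_le (Nat.pow_le_pow_right two_pos hk)),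
        Nat.testBit_lt_two_pow (n'.2.trans_le (Nat.pow_le_pow_right two_pos hk))]
  let y : (Σ j, Fin (l j)) → ZMod 2 := fun r => z r.1 r.2 - S.digits (2 ^ m * a) r.1 r.2
  have h1 : ((Finset.range (2 ^ m)).filter fun n => InCell l z (S.digits (2 ^ m * a + n))).card
      = (Finset.univ.filter fun x => F x = y).card := by
    refine Finset.card_bij (fun n hn => bits ⟨n, Finset.mem_range.1 (Finset.mem_filter.1 hn).1⟩)
      ?_ ?_ ?_
    · intro n hn
      obtain ⟨hn, hc⟩ := Finset.mem_filter.1 hn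
      rw [Finset.mem_range] at hn
      rw [Finset.mem_filter]
      refine ⟨Finset.mem_univ _, funext fun r => ?_⟩
      have := hc r.1 r.2 r.2.2
      rw [S.digits_two_pow_mul_add a m hn] at this
      simp only [y, ← this, add_sub_cancel_left]
      rfl
    · intro n hn n' hn' h
      exact congrArg Fin.val (hbits.1 h)
    · intro x hx
      obtain ⟨n, rfl⟩ := hbits.2 x
      refine ⟨n, Finset.mem_filter.2 ⟨Finset.mem_range.2 n.2, fun j b hb => ?_⟩, rfl⟩
      have := congrFun (Finset.mem_filter.1 hx).2 ⟨j, ⟨b, hb⟩⟩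
      rw [S.digits_two_pow_mul_add a m n.2]
      exact (add_comm _ _).trans (eq_sub_iff_add_eq.1 this)
  have h2 : ∀ y' ∈ (Finset.univ : Finset ((Σ j, Fin (l j)) → ZMod 2)),
      (Finset.univ.filter fun x => F x = y').card = (Finset.univ.filter fun x => F x = y).card :=
    fun y' _ => AddMonoidHom.card_fiber_eq_of_mem_range F (hF y') (hF y)
  have h3 := Finset.card_eq_sum_card_fiberwise (s := (Finset.univ : Finset (Fin m → ZMod 2)))
    (t := Finset.univ) (f := F) fun x _ => Finset.mem_coe.2 (Finset.mem_univ _)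
  rw [Finset.sum_congr rfl h2, Finset.sum_const, smul_eq_mul] at h3
  simp only [Finset.card_univ, Fintype.card_pi, ZMod.card, Finset.prod_const, Fintype.card_fin,
    Fintype.card_sigma] at h3
  rw [h1, mul_comm, ← h3]

open scoped Classical in
/-- In an aligned block of length `2 ^ m`, the number of Sobol' points in an elementary interval
of any shape deviates from its expected value by at most `2 ^ t`. -/
lemma abs_card_inCell_digits_block_le (l : Fin d → ℕ) (m a : ℕ) (z : Fin d → ℕ → ZMod 2) :
    |(((Finset.range (2 ^ m)).filter fun n => InCell l z (S.digits (2 ^ m * a + n))).card : ℝ)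
      - 2 ^ m / 2 ^ (∑ j, l j)| ≤ 2 ^ S.degreeSum := by
  have h2 : (0 : ℝ) ≤ 2 ^ m / 2 ^ (∑ j, l j) := by positivity
  rcases le_or_gt (∑ j, l j + S.degreeSum) m with hm | hm
  · have h := S.card_inCell_digits_eq l m hm a z
    have h' : (((Finset.range (2 ^ m)).filter
        fun n => InCell l z (S.digits (2 ^ m * a + n))).card : ℝ) = 2 ^ m / 2 ^ (∑ j, l j) := by
      rw [eq_div_iff (by positivity)]
      exact_mod_cast h
    rw [h', sub_self, abs_zero]
    positivity
  · have h1 : (((Finset.range (2 ^ m)).filter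
        fun n => InCell l z (S.digits (2 ^ m * a + n))).card : ℝ) ≤ 2 ^ S.degreeSum := by
      rcases le_or_gt S.degreeSum m with ht | ht
      · -- enlarge the interval until it has exactly `2 ^ t` expected points
        obtain ⟨l', hl', hs⟩ := exists_le_sum_eq Finset.univ l (m - S.degreeSum) (by omega)
        have h := S.card_inCell_digits_eq l' m (by omega) a z
        have hle := Finset.card_le_card (Finset.monotone_filter_right (Finset.range (2 ^ m))
          (p := fun n => InCell l z (S.digits (2 ^ m * a + n)))
          (q := fun n => InCell l' z (S.digits (2 ^ m * a + n))) fun n _ hn => hn.mono hl')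
        rw [hs] at h
        have : ((Finset.range (2 ^ m)).filter
            fun n => InCell l' z (S.digits (2 ^ m * a + n))).card = 2 ^ S.degreeSum := by
          refine Nat.eq_of_mul_eq_mul_right (Nat.two_pow_pos (m - S.degreeSum)) ?_
          rw [h, ← pow_add]
          congr 1
          omega
        rw [this] at hle
        exact_mod_cast hle
      · have : ((Finset.range (2 ^ m)).filter
            fun n => InCell l z (S.digits (2 ^ m * a + n))).card ≤ 2 ^ m :=
          (Finset.card_filter_le _ _).trans (by simp)
        have h' := this.trans (Nat.pow_le_pow_right two_pos ht.le)
        exact_mod_cast h'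
    have h3 : (2 : ℝ) ^ m / 2 ^ (∑ j, l j) ≤ 2 ^ S.degreeSum := by
      rw [div_le_iff₀ (by positivity), ← pow_add]
      exact pow_le_pow_right₀ one_le_two (by omega)
    rw [abs_le]
    constructor <;> linarith [Nat.cast_nonneg (α := ℝ) ((Finset.range (2 ^ m)).filter
        fun n => InCell l z (S.digits (2 ^ m * a + n))).card]

open scoped Classical in
/-- Splitting an initial segment of a block into aligned blocks, one for each binary digit of its
length. -/
lemma abs_card_inCell_digits_le (l : Fin d → ℕ) (z : Fin d → ℕ → ZMod 2) (m a M : ℕ)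
    (hM : M < 2 ^ m) :
    |(((Finset.range M).filter fun n => InCell l z (S.digits (2 ^ m * a + n))).card : ℝ)
      - M / 2 ^ (∑ j, l j)| ≤ m * 2 ^ S.degreeSum := by
  induction m generalizing a M with
  | zero =>
    obtain rfl : M = 0 := by simpa using hM
    simp
  | succ m ih =>
    rcases lt_or_ge M (2 ^ m) with h | h
    · have := ih (2 * a) M h
      rw [← mul_assoc, ← pow_succ] at this
      refine this.trans ?_
      push_cast
      gcongr
      simp
    · obtain ⟨M', rfl⟩ := Nat.exists_eq_add_of_le h
      have h1 := S.abs_card_inCell_digits_block_le l m (2 * a) z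
      have h2 := ih (2 * a + 1) M' (by rw [pow_succ] at hM; omega)
      have hcard : ((Finset.range (2 ^ m + M')).filter
            fun n => InCell l z (S.digits (2 ^ (m + 1) * a + n))).card
          = ((Finset.range (2 ^ m)).filter
              fun n => InCell l z (S.digits (2 ^ m * (2 * a) + n))).card
            + ((Finset.range M').filter
              fun n => InCell l z (S.digits (2 ^ m * (2 * a + 1) + n))).card := by
        simp only [Finset.card_filter, Finset.sum_range_add]
        have e1 : ∀ n, 2 ^ (m + 1) * a + n = 2 ^ m * (2 * a) + n := fun n => by ring
        have e2 : ∀ n, 2 ^ m * (2 * a) + (2 ^ m + n) = 2 ^ m * (2 * a + 1) + n := fun n => by ring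
        simp only [e1, e2]
      rw [hcard]
      push_cast
      rw [add_div]
      calc _ = |((((Finset.range (2 ^ m)).filter
              fun n => InCell l z (S.digits (2 ^ m * (2 * a) + n))).card : ℝ)
                - 2 ^ m / 2 ^ (∑ j, l j))
            + ((((Finset.range M').filter
              fun n => InCell l z (S.digits (2 ^ m * (2 * a + 1) + n))).card : ℝ)
                - M' / 2 ^ (∑ j, l j))| := by congr 1; ring
        _ ≤ _ := abs_add_le _ _
        _ ≤ 2 ^ S.degreeSum + m * 2 ^ S.degreeSum := add_le_add h1 h2
        _ = _ := by ring

open scoped Classical in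
lemma abs_card_inCell_scramble_le (π : ScrambleIndex d → ZMod 2) (l : Fin d → ℕ)
    (z : Fin d → ℕ → ZMod 2) (m M : ℕ) (hM : M < 2 ^ m) :
    |(((Finset.range M).filter fun n => InCell l z (scramble π (S.digits n))).card : ℝ)
      - M / 2 ^ (∑ j, l j)| ≤ m * 2 ^ S.degreeSum := by
  obtain ⟨z', hz'⟩ := exists_inCell_scramble_iff π z
  have := S.abs_card_inCell_digits_le l z' m 0 M hM
  simpa only [mul_zero, zero_add, hz'] using this

end SobolSequence

/-! ### From elementary intervals to anchored boxes -/

/-- The integer formed by the first `r` binary digits of `a`. -/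
def digitPrefix (a : ℕ → ZMod 2) : ℕ → ℕ
  | 0 => 0
  | r + 1 => 2 * digitPrefix a r + (a r).val

lemma digitPrefix_lt (a : ℕ → ZMod 2) (r : ℕ) : digitPrefix a r < 2 ^ r := by
  induction r with
  | zero => simp [digitPrefix]
  | succ r ih =>
    have := ZMod.val_lt (a r)
    rw [digitPrefix, pow_succ]
    omega

lemma exists_digitPrefix_eq_iff (l q : ℕ) (hq : q < 2 ^ l) :
    ∃ z : ℕ → ZMod 2, ∀ a, digitPrefix a l = q ↔ ∀ b < l, a b = z b := by
  induction l generalizing q with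
  | zero => exact ⟨0, fun a => by simp at hq; simp [digitPrefix, hq]⟩
  | succ l ih =>
    obtain ⟨z, hz⟩ := ih (q / 2) (by rw [pow_succ] at hq; omega)
    refine ⟨Function.update z l ((q % 2 : ℕ) : ZMod 2), fun a => ?_⟩
    have h1 : (∀ b < l, a b = Function.update z l ((q % 2 : ℕ) : ZMod 2) b) ↔
        ∀ b < l, a b = z b :=
      forall₂_congr fun b hb => by rw [Function.update_of_ne hb.ne]
    rw [Nat.forall_lt_succ_right, h1, ← hz a, Function.update_self, digitPrefix]
    have hv := ZMod.val_lt (a l)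
    have h2 : a l = ((q % 2 : ℕ) : ZMod 2) ↔ (a l).val = q % 2 := by
      constructor
      · intro h
        rw [h, ZMod.val_natCast, Nat.mod_mod]
      · intro h
        rw [← h, ZMod.natCast_zmod_val]
    rw [h2]
    omega

/-- The indicator of `{x < c / 2 ^ r}` is a combination, with coefficients in `[0, 1]`, of
indicators of elementary intervals, one of each length `2 ^ (-i)`, `i ≤ r`. -/
lemma exists_indicator_digitPrefix_lt_eq_sum (r c : ℕ) (hc : c ≤ 2 ^ r) :
    ∃ (κ : ℕ → ℝ) (z : ℕ → ℕ → ZMod 2), (∀ i, 0 ≤ κ i ∧ κ i ≤ 1) ∧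
      (c : ℝ) / 2 ^ r = ∑ i ∈ Finset.range (r + 1), κ i / 2 ^ i ∧
      ∀ a, (if digitPrefix a r < c then (1 : ℝ) else 0)
        = ∑ i ∈ Finset.range (r + 1), κ i * if ∀ b < i, a b = z i b then 1 else 0 := by
  induction r generalizing c with
  | zero =>
    refine ⟨fun _ => c, fun _ _ => 0, fun _ => ⟨by positivity, by exact_mod_cast (by simpa using hc)⟩,
      by simp, fun a => ?_⟩
    have : c = 0 ∨ c = 1 := by
      rw [pow_zero] at hc
      omega
    rw [zero_add, Finset.sum_range_one]
    rcases this with rfl | rfl <;> simp [digitPrefix]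
  | succ r ih =>
    rw [pow_succ] at hc
    obtain ⟨κ, z, hκ, hvol, hind⟩ := ih (c / 2) (by omega)
    -- the interval of length `2 ^ (-(r + 1))` is needed exactly if the last bit of `c` is one
    obtain ⟨z', hz'⟩ : ∃ z' : ℕ → ZMod 2,
        ∀ a, (if digitPrefix a (r + 1) < c then (1 : ℝ) else 0)
          = (if digitPrefix a r < c / 2 then 1 else 0)
            + (c % 2 : ℕ) * if ∀ b < r + 1, a b = z' b then 1 else 0 := by
      rcases Nat.mod_two_eq_zero_or_one c with h | h
      · refine ⟨0, fun a => ?_⟩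
        have hv := ZMod.val_lt (a r)
        have : digitPrefix a (r + 1) < c ↔ digitPrefix a r < c / 2 := by
          rw [digitPrefix]
          omega
        simp [this, h]
      · obtain ⟨z', hz'⟩ := exists_digitPrefix_eq_iff (r + 1) (c - 1) (by rw [pow_succ]; omega)
        refine ⟨z', fun a => ?_⟩
        have hv := ZMod.val_lt (a r)
        have hp : digitPrefix a (r + 1) = 2 * digitPrefix a r + (a r).val := rfl
        simp only [← hz' a, h]
        by_cases h1 : digitPrefix a r < c / 2
        · rw [if_pos (by omega), if_pos h1, if_neg (by omega)]
          simp
        · by_cases h2 : digitPrefix a (r + 1) = c - 1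
          · rw [if_pos (by omega), if_neg h1, if_pos h2]
            simp
          · rw [if_neg (by omega), if_neg h1, if_neg h2]
            simp
    refine ⟨Function.update κ (r + 1) (c % 2 : ℕ), Function.update z (r + 1) z', ?_, ?_, ?_⟩
    · intro i
      rcases eq_or_ne i (r + 1) with rfl | hi
      · rw [Function.update_self]
        have : c % 2 ≤ 1 := by omega
        exact ⟨by positivity, by exact_mod_cast this⟩
      · rw [Function.update_of_ne hi]
        exact hκ i
    · rw [Finset.sum_range_succ, Function.update_self, Finset.sum_congr rfl fun i hi => by
        rw [Function.update_of_ne (Finset.mem_range.1 hi).ne], ← hvol, pow_succ]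
      have : (c : ℝ) = 2 * (c / 2 : ℕ) + (c % 2 : ℕ) := by
        exact_mod_cast (Nat.div_add_mod c 2).symm
      rw [this]
      field_simp
    · intro a
      rw [Finset.sum_range_succ, Function.update_self, Function.update_self, hz', hind]
      congr 1
      refine Finset.sum_congr rfl fun i hi => ?_
      rw [Function.update_of_ne (Finset.mem_range.1 hi).ne,
        Function.update_of_ne (Finset.mem_range.1 hi).ne]

lemma sum_digits_eq_digitPrefix (a : ℕ → ZMod 2) (r : ℕ) :
    ∑ b ∈ Finset.range r, ((a b).val : ℝ) / 2 ^ (b + 1) = digitPrefix a r / 2 ^ r := by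
  induction r with
  | zero => simp [digitPrefix]
  | succ r ih =>
    rw [Finset.sum_range_succ, ih, digitPrefix]
    push_cast
    rw [pow_succ]
    field_simp

lemma digit_term_le (a : ℕ → ZMod 2) (b : ℕ) :
    ((a b).val : ℝ) / 2 ^ (b + 1) ≤ 1 / 2 / 2 ^ b := by
  have h : ((a b).val : ℝ) ≤ 1 := by
    have := ZMod.val_lt (a b)
    exact_mod_cast Nat.lt_succ_iff.1 this
  rw [pow_succ', div_div]
  gcongr

lemma summable_digits (a : ℕ → ZMod 2) : Summable fun b : ℕ => ((a b).val : ℝ) / 2 ^ (b + 1) :=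
  Summable.of_nonneg_of_le (fun _ => by positivity) (digit_term_le a) (summable_geometric_two' 1)

lemma digitPrefix_div_le_ofDigits {d : ℕ} (a : Fin d → ℕ → ZMod 2) (j : Fin d) (r : ℕ) :
    digitPrefix (a j) r / 2 ^ r ≤ ofDigits a j := by
  rw [← sum_digits_eq_digitPrefix]
  exact (summable_digits (a j)).sum_le_tsum _ fun _ _ => by positivity

lemma ofDigits_le_digitPrefix_add_one_div {d : ℕ} (a : Fin d → ℕ → ZMod 2) (j : Fin d) (r : ℕ) :
    ofDigits a j ≤ (digitPrefix (a j) r + 1) / 2 ^ r := by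
  have h := (summable_digits (a j)).sum_add_tsum_nat_add r
  rw [ofDigits, ← h, sum_digits_eq_digitPrefix, add_div]
  gcongr
  have h1 : Summable fun b : ℕ => (1 / 2 / 2 ^ b : ℝ) := summable_geometric_two' 1
  have h2 : ∑' b : ℕ, (1 / 2 ^ r * (1 / 2 / 2 ^ b) : ℝ) = 1 / 2 ^ r := by
    rw [tsum_mul_left, tsum_geometric_two', mul_one]
  rw [← h2]
  refine Summable.tsum_le_tsum (fun b => ?_) ((summable_nat_add_iff r).2 (summable_digits (a j)))
    (h1.mul_left _)
  refine (digit_term_le (a j) (b + r)).trans (le_of_eq ?_)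
  rw [pow_add]
  field_simp

lemma ofDigits_mem_unitCube {d : ℕ} (a : Fin d → ℕ → ZMod 2) : ofDigits a ∈ unitCube d :=
  ⟨fun j => by simpa [digitPrefix] using digitPrefix_div_le_ofDigits a j 0,
    fun j => by simpa [digitPrefix] using ofDigits_le_digitPrefix_add_one_div a j 0⟩

lemma abs_prod_sub_prod_le_sum {ι : Type*} (s : Finset ι) (x y : ι → ℝ)
    (hx : ∀ i, 0 ≤ x i ∧ x i ≤ 1) (hy : ∀ i, 0 ≤ y i ∧ y i ≤ 1) :
    |∏ i ∈ s, x i - ∏ i ∈ s, y i| ≤ ∑ i ∈ s, |x i - y i| := by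
  classical
  induction s using Finset.induction_on with
  | empty => simp
  | insert i s hi ih =>
    rw [Finset.prod_insert hi, Finset.prod_insert hi, Finset.sum_insert hi]
    have h1 : |∏ k ∈ s, x k| ≤ 1 := by
      rw [abs_of_nonneg (Finset.prod_nonneg fun k _ => (hx k).1)]
      exact Finset.prod_le_one (fun k _ => (hx k).1) fun k _ => (hx k).2
    have h2 : |y i| ≤ 1 := by
      rw [abs_of_nonneg (hy i).1]
      exact (hy i).2
    calc |x i * ∏ k ∈ s, x k - y i * ∏ k ∈ s, y k|
        = |(x i - y i) * ∏ k ∈ s, x k + y i * (∏ k ∈ s, x k - ∏ k ∈ s, y k)| := by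
          congr 1; ring
      _ ≤ |x i - y i| * |∏ k ∈ s, x k| + |y i| * |∏ k ∈ s, x k - ∏ k ∈ s, y k| := by
          rw [← abs_mul, ← abs_mul]
          exact abs_add_le _ _
      _ ≤ |x i - y i| * 1 + 1 * ∑ k ∈ s, |x k - y k| := by gcongr
      _ = _ := by ring

section

variable {d : ℕ} {Ω : Type*} [MeasurableSpace Ω] {μ : Measure Ω} [IsProbabilityMeasure μ]
  {a : Ω → Fin d → ℕ → ZMod 2}

lemma measurableSet_inCell (ha : ∀ j b, Measurable fun ω => a ω j b) (l : Fin d → ℕ)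
    (z : Fin d → ℕ → ZMod 2) : MeasurableSet {ω | InCell l z (a ω)} := by
  simp only [InCell, Set.ofPred_forall]
  exact MeasurableSet.iInter fun j => MeasurableSet.iInter fun b => MeasurableSet.iInter fun _ =>
    ha j b (measurableSet_singleton _)

lemma measurable_digitPrefix (ha : ∀ j b, Measurable fun ω => a ω j b) (j : Fin d) (r : ℕ) :
    Measurable fun ω => digitPrefix (a ω j) r := by
  induction r with
  | zero => exact measurable_const
  | succ r ih =>
    exact (measurable_const.mul ih).add ((measurable_of_countable ZMod.val).comp (ha j r))

/-- If random digits hit every elementary interval with the right probability up to `δ`, then they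
hit every dyadic anchored box of resolution `2 ^ (-r)` with the right probability up to
`(r + 1) ^ d * δ`. -/
lemma abs_measureReal_dyadicBox_sub_le (ha : ∀ j b, Measurable fun ω => a ω j b) {δ : ℝ}
    (hδ : ∀ l z, |μ.real {ω | InCell l z (a ω)} - 1 / 2 ^ (∑ j, l j)| ≤ δ) (r : ℕ)
    (c : Fin d → ℕ) (hc : ∀ j, c j ≤ 2 ^ r) :
    |μ.real {ω | ∀ j, digitPrefix (a ω j) r < c j} - ∏ j, (c j : ℝ) / 2 ^ r|
      ≤ (r + 1) ^ d * δ := by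
  classical
  choose κ z hκ hvol hind using fun j => exists_indicator_digitPrefix_lt_eq_sum r (c j) (hc j)
  have hmeas : MeasurableSet {ω | ∀ j, digitPrefix (a ω j) r < c j} := by
    simp only [Set.ofPred_forall]
    exact MeasurableSet.iInter fun j => measurable_digitPrefix ha j r measurableSet_Iio
  let T := Fintype.piFinset fun _ : Fin d => Finset.range (r + 1)
  have hprob : μ.real {ω | ∀ j, digitPrefix (a ω j) r < c j}
      = ∑ l ∈ T, (∏ j, κ j (l j)) * μ.real {ω | InCell l (fun j => z j (l j)) (a ω)} := by
    rw [← integral_indicator_one hmeas]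
    have h1 : ∀ ω, {ω | ∀ j, digitPrefix (a ω j) r < c j}.indicator (1 : Ω → ℝ) ω
        = ∑ l ∈ T, (∏ j, κ j (l j))
          * {ω | InCell l (fun j => z j (l j)) (a ω)}.indicator (1 : Ω → ℝ) ω := by
      intro ω
      have h2 : {ω | ∀ j, digitPrefix (a ω j) r < c j}.indicator (1 : Ω → ℝ) ω
          = ∏ j, if digitPrefix (a ω j) r < c j then 1 else 0 := by
        rw [Finset.prod_ite_zero]
        simp [Set.indicator_apply]
      rw [h2, Finset.prod_congr rfl fun j _ => hind j (a ω j), Finset.prod_univ_sum]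
      refine Finset.sum_congr rfl fun l _ => ?_
      rw [Finset.prod_mul_distrib, Finset.prod_ite_zero]
      simp [Set.indicator_apply, InCell]
    simp only [h1]
    rw [integral_finsetSum]
    · refine Finset.sum_congr rfl fun l _ => ?_
      rw [integral_const_mul, integral_indicator_one (measurableSet_inCell ha _ _)]
    · intro l _
      exact ((integrable_const (1 : ℝ)).indicator (measurableSet_inCell ha _ _)).const_mul _
  have hprod : ∏ j, (c j : ℝ) / 2 ^ r = ∑ l ∈ T, (∏ j, κ j (l j)) * (1 / 2 ^ (∑ j, l j)) := by
    rw [Finset.prod_congr rfl fun j _ => hvol j, Finset.prod_univ_sum]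
    refine Finset.sum_congr rfl fun l _ => ?_
    rw [Finset.prod_div_distrib, Finset.prod_pow_eq_pow_sum, mul_one_div]
  rw [hprob, hprod, ← Finset.sum_sub_distrib]
  have hT : (T.card : ℝ) = (r + 1) ^ d := by simp [T]
  rw [← hT, ← nsmul_eq_mul]
  refine (Finset.abs_sum_le_sum_abs _ _).trans (Finset.sum_le_card_nsmul _ _ _ fun l _ => ?_)
  rw [← mul_sub, abs_mul, abs_of_nonneg (Finset.prod_nonneg fun j _ => (hκ j (l j)).1)]
  calc _ ≤ 1 * δ := mul_le_mul (Finset.prod_le_one (fun j _ => (hκ j (l j)).1)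
        fun j _ => (hκ j (l j)).2) (hδ _ _) (abs_nonneg _) zero_le_one
    _ = δ := one_mul δ

/-- The analogue for a box `∏ [0, s j)` with arbitrary corner, possibly with a part of its upper
boundary added. -/
lemma abs_measureReal_box_sub_le (ha : ∀ j b, Measurable fun ω => a ω j b) {δ : ℝ}
    (hδ : ∀ l z, |μ.real {ω | InCell l z (a ω)} - 1 / 2 ^ (∑ j, l j)| ≤ δ) (r : ℕ)
    (s : Fin d → ℝ) (hs : s ∈ unitCube d) (B : Set Ω)
    (hB1 : ∀ ω, (∀ j, ofDigits (a ω) j < s j) → ω ∈ B)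
    (hB2 : ∀ ω ∈ B, ∀ j, ofDigits (a ω) j ≤ s j) :
    |μ.real B - ∏ j, s j| ≤ (r + 1) ^ d * δ + d / 2 ^ r := by
  have hs0 : ∀ j, 0 ≤ s j := fun j => hs.1 j
  have hs1 : ∀ j, s j ≤ 1 := fun j => hs.2 j
  have h2r : (0 : ℝ) < 2 ^ r := by positivity
  have approx : ∀ c : Fin d → ℕ, (∀ j, c j ≤ 2 ^ r) → (∀ j, |(c j : ℝ) - s j * 2 ^ r| ≤ 1) →
      |μ.real {ω | ∀ j, digitPrefix (a ω j) r < c j} - ∏ j, s j|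
        ≤ (r + 1) ^ d * δ + d / 2 ^ r := by
    intro c hc hcs
    have h1 := abs_measureReal_dyadicBox_sub_le ha hδ r c hc
    have h2 := abs_prod_sub_prod_le_sum Finset.univ (fun j => (c j : ℝ) / 2 ^ r) s
      (fun j => ⟨by positivity, by
        rw [div_le_one h2r]
        exact_mod_cast hc j⟩) (fun j => ⟨hs0 j, hs1 j⟩)
    have h3 : ∑ j, |(c j : ℝ) / 2 ^ r - s j| ≤ d / 2 ^ r := by
      have : ∀ j ∈ (Finset.univ : Finset (Fin d)), |(c j : ℝ) / 2 ^ r - s j| ≤ 1 / 2 ^ r := by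
        intro j _
        have e : (c j : ℝ) / 2 ^ r - s j = (c j - s j * 2 ^ r) / 2 ^ r := by field_simp
        rw [e, abs_div, abs_of_pos h2r]
        gcongr
        exact hcs j
      refine (Finset.sum_le_card_nsmul _ _ _ this).trans (le_of_eq ?_)
      simp [div_eq_mul_inv]
    exact (abs_sub_le _ _ _).trans (add_le_add h1 (h2.trans h3))
  -- the smallest dyadic box covering the closed box
  have hup := approx (fun j => min (⌊s j * 2 ^ r⌋₊ + 1) (2 ^ r)) (fun j => min_le_right _ _) (by
    intro j
    have h0 : 0 ≤ s j * 2 ^ r := mul_nonneg (hs0 j) h2r.le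
    have h1 : s j * 2 ^ r ≤ 2 ^ r := mul_le_of_le_one_left h2r.le (hs1 j)
    have f1 := Nat.floor_le h0
    have f2 := Nat.lt_floor_add_one (s j * 2 ^ r)
    push_cast
    rw [abs_le]
    constructor
    · rcases min_cases ((⌊s j * 2 ^ r⌋₊ : ℝ) + 1) (2 ^ r) with h | h <;> rw [h.1] <;> linarith
    · have := min_le_left ((⌊s j * 2 ^ r⌋₊ : ℝ) + 1) (2 ^ r)
      linarith)
  -- the largest dyadic box whose closed cells lie in the half-open box; truncated subtraction gives
  -- the empty box if `s j = 0`
  have hlo := approx (fun j => ⌈s j * 2 ^ r⌉₊ - 1) (fun j => by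
      have h1 : s j * 2 ^ r ≤ ((2 ^ r : ℕ) : ℝ) := by
        push_cast
        exact mul_le_of_le_one_left h2r.le (hs1 j)
      have := Nat.ceil_le.2 h1
      omega) (by
    intro j
    have h0 : 0 ≤ s j * 2 ^ r := mul_nonneg (hs0 j) h2r.le
    have f1 := Nat.le_ceil (s j * 2 ^ r)
    have f2 := Nat.ceil_lt_add_one h0
    rcases Nat.eq_zero_or_pos ⌈s j * 2 ^ r⌉₊ with h | h
    · rw [h] at f1 ⊢
      have : s j * 2 ^ r = 0 := le_antisymm (by simpa using f1) h0
      rw [this]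
      simp
    · rw [Nat.cast_sub h]
      push_cast
      rw [abs_le]
      constructor <;> linarith)
  have hBup : μ.real B ≤ μ.real {ω | ∀ j, digitPrefix (a ω j) r
      < min (⌊s j * 2 ^ r⌋₊ + 1) (2 ^ r)} := by
    refine measureReal_mono fun ω hω j => lt_min (Nat.lt_succ_of_le (Nat.le_floor ?_))
      (digitPrefix_lt _ _)
    rw [← div_le_iff₀ h2r]
    exact (digitPrefix_div_le_ofDigits (a ω) j r).trans (hB2 ω hω j)
  have hBlo : μ.real {ω | ∀ j, digitPrefix (a ω j) r < ⌈s j * 2 ^ r⌉₊ - 1} ≤ μ.real B := by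
    refine measureReal_mono fun ω hω => hB1 ω fun j => ?_
    refine (ofDigits_le_digitPrefix_add_one_div (a ω) j r).trans_lt ?_
    rw [div_lt_iff₀ h2r]
    have h1 : digitPrefix (a ω j) r < ⌈s j * 2 ^ r⌉₊ - 1 := hω j
    have h2 := Nat.lt_ceil.1 (show digitPrefix (a ω j) r + 1 < ⌈s j * 2 ^ r⌉₊ by omega)
    exact_mod_cast h2
  rw [abs_le] at hup hlo ⊢
  constructor <;> linarith [hup.1, hup.2, hlo.1, hlo.2]

end

namespace SobolSequence

variable {d : ℕ} (S : SobolSequence d)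

/-- An explicit bound of order `M⁻¹ (log M) ^ (d + 1)` for the discrepancy of `M` points. -/
noncomputable def discBound (M : ℕ) : ℝ :=
  (2 ^ S.degreeSum + d) * (Nat.log 2 M + 2) ^ (d + 1) / M

open scoped Classical in
/-- Every scrambling of a Sobol' sequence has discrepancy at most `discBound`, uniformly over
boxes that contain an arbitrary part of their upper boundary. -/
lemma abs_card_box_sub_le (π : ScrambleIndex d → ZMod 2) (M : ℕ) (hM : 1 ≤ M) (s : Fin d → ℝ)
    (hs : s ∈ unitCube d) (B : Set (Fin d → ℝ))
    (hB1 : ∀ x ∈ unitCube d, (∀ j, x j < s j) → x ∈ B)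
    (hB2 : ∀ x ∈ unitCube d, x ∈ B → ∀ j, x j ≤ s j) :
    |(((Finset.range M).filter fun n => S.scrambledPoint π n ∈ B).card : ℝ) / M - ∏ j, s j|
      ≤ S.discBound M := by
  -- the empirical measure on the indices
  let μ : Measure (Fin M) := (M : ℝ≥0∞)⁻¹ • Measure.count
  have hM0 : (M : ℝ≥0∞) ≠ 0 := by exact_mod_cast (by omega : M ≠ 0)
  have hMpos : (0 : ℝ) < M := by exact_mod_cast hM
  have : IsProbabilityMeasure μ := ⟨by
    simp only [μ, Measure.smul_apply, Measure.count_univ, smul_eq_mul]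
    simp [ENNReal.inv_mul_cancel hM0 (ENNReal.natCast_ne_top M)]⟩
  have hμ : ∀ p : ℕ → Prop, μ.real {n : Fin M | p n}
      = (((Finset.range M).filter p).card : ℝ) / M := by
    intro p
    have h1 : (Finset.univ.filter fun n : Fin M => p n).card
        = ((Finset.range M).filter p).card := by
      rw [Finset.card_filter, Finset.card_filter, Finset.sum_range]
    rw [measureReal_ennreal_smul_apply, ENNReal.toReal_inv, ENNReal.toReal_natCast, ← h1,
      Measure.real, Measure.count_apply (Set.toFinite _).measurableSet, div_eq_inv_mul,
      Set.encard_eq_coe_toFinset_card]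
    simp
  -- the resolution at which the shell `d / 2 ^ r` is below `d / M`
  set r := Nat.log 2 M + 1 with hr
  have hMr : M < 2 ^ r := Nat.lt_pow_succ_log_self one_lt_two M
  have hcell : ∀ l z, |μ.real {n : Fin M | InCell l z (scramble π (S.digits n))}
      - 1 / 2 ^ (∑ j, l j)| ≤ r * 2 ^ S.degreeSum / M := by
    intro l z
    have h := S.abs_card_inCell_scramble_le π l z r M hMr
    rw [hμ fun n => InCell l z (scramble π (S.digits n))]
    rw [le_div_iff₀ hMpos, ← abs_of_pos hMpos, ← abs_mul, abs_of_pos hMpos, sub_mul,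
      div_mul_cancel₀ _ hMpos.ne', one_div_mul_eq_div]
    exact h
  have h := abs_measureReal_box_sub_le (μ := μ) (a := fun n : Fin M => scramble π (S.digits n))
    (fun _ _ => measurable_of_countable _) hcell r s hs {n | S.scrambledPoint π n ∈ B}
    (fun n hn => hB1 _ (ofDigits_mem_unitCube _) hn)
    (fun n hn => hB2 _ (ofDigits_mem_unitCube _) hn)
  rw [hμ fun n => S.scrambledPoint π n ∈ B] at h
  refine h.trans ?_
  have hr' : (r : ℝ) + 1 = Nat.log 2 M + 2 := by
    rw [hr]
    push_cast
    ring
  have h1 : (d : ℝ) / 2 ^ r ≤ d * (r + 1) ^ (d + 1) / M := by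
    have : (M : ℝ) ≤ 2 ^ r := by exact_mod_cast hMr.le
    refine (div_le_div_of_nonneg_left (by positivity) hMpos this).trans ?_
    gcongr
    exact le_mul_of_one_le_right (by positivity)
      (one_le_pow₀ (by linarith [Nat.cast_nonneg (α := ℝ) r]))
  have h2 : ((r : ℝ) + 1) ^ d * (r * 2 ^ S.degreeSum / M)
      ≤ 2 ^ S.degreeSum * (r + 1) ^ (d + 1) / M := by
    rw [pow_succ, ← mul_div_assoc]
    gcongr ?_ / _
    calc ((r : ℝ) + 1) ^ d * (r * 2 ^ S.degreeSum)
        ≤ ((r : ℝ) + 1) ^ d * ((r + 1) * 2 ^ S.degreeSum) := by gcongr; linarith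
      _ = _ := by ring
  rw [discBound, ← hr', add_mul, add_div]
  exact add_le_add h2 h1

lemma starDiscrepancy_scrambledPoint_le (π : ScrambleIndex d → ZMod 2) (M : ℕ) (hM : 1 ≤ M) :
    starDiscrepancy M (S.scrambledPoint π) ≤ S.discBound M := by
  classical
  have : Nonempty (unitCube d) := ⟨⟨0, ⟨le_refl _, fun _ => zero_le_one⟩⟩⟩
  refine ciSup_le fun s => ?_
  have h := S.abs_card_box_sub_le π M hM s.1 s.2 (Set.univ.pi fun i => Set.Ico 0 (s.1 i))
    (fun x hx hxs i _ => ⟨hx.1 i, hxs i⟩) (fun x _ hx i => (hx i trivial).2.le)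
  have e : ∑ m ∈ Finset.range M, (Set.univ.pi fun i => Set.Ico 0 (s.1 i)).indicator
      (fun _ => (1 : ℝ)) (S.scrambledPoint π m)
      = ((Finset.range M).filter fun n => S.scrambledPoint π n ∈
          Set.univ.pi fun i => Set.Ico 0 (s.1 i)).card := by
    rw [Finset.card_filter]
    push_cast
    exact Finset.sum_congr rfl fun m _ => by simp only [Set.indicator_apply]
  rw [e]
  exact h

lemma point_eq_scrambledPoint_zero : S.point = S.scrambledPoint 0 := by
  funext n
  simp only [point, scrambledPoint]
  congr 1
  funext j b
  simp [scramble]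

end SobolSequence

/-! ### The Koksma--Hlawka inequality for two finite point sets -/

lemma single_eq_single_add_sum_smul {k n : ℕ} (hk : k ≤ n) :
    (Pi.single k 1 : ℕ → ℝ) = Pi.single n 1 + ∑ c ∈ Finset.range n,
      (if k ≤ c then (-1 : ℝ) else 0) • (Pi.single (c + 1) 1 - Pi.single c 1 : ℕ → ℝ) := by
  induction n, hk using Nat.le_induction with
  | base =>
    rw [Finset.sum_eq_zero, add_zero]
    intro c hc
    rw [if_neg (by simpa using hc), zero_smul]
  | succ n hn ih =>
    rw [Finset.sum_range_succ, if_pos hn]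
    nth_rewrite 1 [ih]
    module

/-- The multilinear extension of the restriction of `φ` to the grid `p 0, …, p n`: a product of
coefficient vectors `h i` is sent to `∑ t, (∏ i, h i (t i)) * φ (p ∘ t)`. -/
noncomputable def gridForm {d : ℕ} (φ : (Fin d → ℝ) → ℝ) (p : ℕ → ℝ) (n : ℕ) :
    MultilinearMap ℝ (fun _ : Fin d => ℕ → ℝ) ℝ :=
  ∑ t ∈ Fintype.piFinset fun _ : Fin d => Finset.range (n + 1),
    φ (fun i => p (t i)) •
      (MultilinearMap.mkPiAlgebra ℝ (Fin d) ℝ).compLinearMap fun i => LinearMap.proj (t i)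

lemma gridForm_single {d : ℕ} (φ : (Fin d → ℝ) → ℝ) (p : ℕ → ℝ) (n : ℕ) (k : Fin d → ℕ)
    (hk : ∀ i, k i ≤ n) :
    gridForm φ p n (fun i => Pi.single (k i) 1) = φ fun i => p (k i) := by
  simp only [gridForm, sum_apply, smul_apply,
    MultilinearMap.compLinearMap_apply, MultilinearMap.mkPiAlgebra_apply, LinearMap.proj_apply,
    smul_eq_mul]
  rw [Finset.sum_eq_single k]
  · simp
  · intro t _ htk
    obtain ⟨i, hi⟩ := Function.ne_iff.1 htk
    rw [Finset.prod_eq_zero (Finset.mem_univ i) (Pi.single_eq_of_ne hi _), mul_zero]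
  · intro h
    exact absurd (Fintype.mem_piFinset.2 fun i => Finset.mem_range.2 (by have := hk i; omega)) h

lemma gridForm_piecewise_sub {d : ℕ} (φ : (Fin d → ℝ) → ℝ) (p : ℕ → ℝ) (n : ℕ) (hp : p n = 1)
    (u : Finset (Fin d)) (c : Fin d → ℕ) (hc : ∀ i ∈ u, c i < n) :
    gridForm φ p n (fun i => if i ∈ u then Pi.single (c i + 1) 1 - Pi.single (c i) 1
        else Pi.single n 1)
      = boxDifference φ u (fun i => p (c i)) (fun i => p (c i + 1)) := by
  have h1 : (fun i => if i ∈ u then Pi.single (c i + 1) 1 - Pi.single (c i) 1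
        else Pi.single n 1 : Fin d → ℕ → ℝ)
      = u.piecewise
          ((fun i => (-1 : ℝ) • Pi.single (c i) (1 : ℝ))
            + fun i => Pi.single (if i ∈ u then c i + 1 else n) 1)
          (fun i => Pi.single (if i ∈ u then c i + 1 else n) 1) := by
    funext i
    by_cases hi : i ∈ u
    · simp [hi]
      abel
    · simp [hi]
  rw [h1, MultilinearMap.map_piecewise_add, boxDifference]
  refine Finset.sum_congr rfl fun v hv => ?_
  have hvu := Finset.mem_powerset.1 hv
  let m : Fin d → ℕ → ℝ := fun i =>
    Pi.single (if i ∈ v then c i else if i ∈ u then c i + 1 else n) 1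
  have h2 : v.piecewise (fun i => (-1 : ℝ) • Pi.single (c i) (1 : ℝ))
      (fun i => Pi.single (if i ∈ u then c i + 1 else n) 1)
      = v.piecewise (fun i => (-1 : ℝ) • m i) m := by
    funext i
    by_cases hi : i ∈ v <;> simp [hi, m]
  rw [h2, MultilinearMap.map_piecewise_smul, gridForm_single, Finset.prod_const, smul_eq_mul]
  · congr 2
    funext i
    split_ifs
    · rfl
    · rfl
    · exact hp
  · intro i
    split_ifs with h3 h4
    · exact (hc i (hvu h3)).le
    · exact hc i h4
    · exact le_rfl

/-- Summation by parts in all coordinates: the value at a grid point, as a sum of the alternating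
sums over the cells above it on all faces through `(1, …, 1)`. -/
lemma eq_sum_boxDifference {d : ℕ} (φ : (Fin d → ℝ) → ℝ) (p : ℕ → ℝ) (n : ℕ) (hp : p n = 1)
    (k : Fin d → ℕ) (hk : ∀ i, k i ≤ n) :
    φ (fun i => p (k i)) = ∑ u : Finset (Fin d),
      ∑ c ∈ Fintype.piFinset fun i => if i ∈ u then Finset.range n else {0},
        (∏ i ∈ u, if k i ≤ c i then (-1 : ℝ) else 0)
          * boxDifference φ u (fun i => p (c i)) (fun i => p (c i + 1)) := by
  rw [← gridForm_single φ p n k hk]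
  have h1 : (fun i => Pi.single (k i) 1 : Fin d → ℕ → ℝ)
      = (fun i => ∑ c ∈ Finset.range n,
          (if k i ≤ c then (-1 : ℝ) else 0) • (Pi.single (c + 1) 1 - Pi.single c 1 : ℕ → ℝ))
        + fun _ => Pi.single n 1 := by
    funext i
    rw [single_eq_single_add_sum_smul (hk i), add_comm]
    rfl
  rw [h1, MultilinearMap.map_add_univ]
  refine Finset.sum_congr rfl fun u _ => ?_
  have h2 : u.piecewise (fun i => ∑ c ∈ Finset.range n,
          (if k i ≤ c then (-1 : ℝ) else 0) • (Pi.single (c + 1) 1 - Pi.single c 1 : ℕ → ℝ))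
        (fun _ => Pi.single n 1)
      = fun i => ∑ c ∈ (if i ∈ u then Finset.range n else {0}),
          if i ∈ u then (if k i ≤ c then (-1 : ℝ) else 0)
            • (Pi.single (c + 1) 1 - Pi.single c 1 : ℕ → ℝ) else Pi.single n 1 := by
    funext i
    by_cases hi : i ∈ u <;> simp [hi]
  rw [h2]
  refine (MultilinearMap.map_sum_finset (gridForm φ p n) (fun i c => if i ∈ u then
    (if k i ≤ c then (-1 : ℝ) else 0) • (Pi.single (c + 1) 1 - Pi.single c 1 : ℕ → ℝ)
      else Pi.single n 1) fun i => if i ∈ u then Finset.range n else {0}).trans ?_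
  refine Finset.sum_congr rfl fun c hc => ?_
  rw [Fintype.mem_piFinset] at hc
  have hc' : ∀ i ∈ u, c i < n := fun i hi => by
    have := hc i
    rw [if_pos hi] at this
    exact Finset.mem_range.1 this
  rw [← gridForm_piecewise_sub φ p n hp u c hc', ← smul_eq_mul,
    ← MultilinearMap.map_piecewise_smul]
  congr 1
  funext i
  by_cases hi : i ∈ u <;> simp [hi]

lemma exists_grid (F : Finset ℝ) (hF : ∀ x ∈ F, x ∈ Set.Icc (0 : ℝ) 1) (h1 : 1 ∈ F) :
    ∃ (n : ℕ) (p : ℕ → ℝ) (κ : ℝ → ℕ), Monotone p ∧ (∀ j, p j ∈ Set.Icc (0 : ℝ) 1) ∧ p n = 1 ∧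
      ∀ x ∈ F, κ x ≤ n ∧ p (κ x) = x ∧ ∀ c < n, (κ x ≤ c ↔ x ≤ p c) := by
  have hpos : 0 < F.card := Finset.card_pos.2 ⟨1, h1⟩
  obtain ⟨n, hn⟩ : ∃ n, F.card = n + 1 := ⟨F.card - 1, by omega⟩
  let e := F.orderEmbOfFin hn
  let p : ℕ → ℝ := fun k => e ⟨min k n, by omega⟩
  have hex : ∀ x ∈ F, ∃ k ≤ n, p k = x := by
    intro x hx
    have : x ∈ Set.range e := by
      rw [Finset.range_orderEmbOfFin]
      exact hx
    obtain ⟨i, hi⟩ := this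
    refine ⟨i, by omega, ?_⟩
    rw [← hi]
    refine congrArg e (Fin.ext ?_)
    simp only
    omega
  choose! κ hκ1 hκ2 using hex
  have hle : ∀ {a b : ℕ}, p a ≤ p b ↔ min a n ≤ min b n := fun {a b} => by
    simp only [p, OrderEmbedding.le_iff_le, Fin.mk_le_mk]
  have hmem : ∀ j, p j ∈ F := fun j => Finset.orderEmbOfFin_mem F hn _
  refine ⟨n, p, κ, fun a b hab => hle.2 (by omega), fun j => hF _ (hmem j), ?_,
    fun x hx => ⟨hκ1 x hx, hκ2 x hx, fun c hc => ?_⟩⟩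
  · refine le_antisymm (hF _ (hmem n)).2 ?_
    rw [← hκ2 1 h1, hle]
    have := hκ1 1 h1
    omega
  · have h3 := hκ1 x hx
    nth_rewrite 2 [← hκ2 x hx]
    rw [hle]
    omega

open scoped Classical in
/-- Koksma--Hlawka inequality: the means of `φ` over two finite point sets differ by at most the
variation of `φ` times the largest difference of the proportions of points in anchored boxes. -/
theorem abs_mean_sub_mean_le {d : ℕ} (φ : (Fin d → ℝ) → ℝ) (hφ : hardyKrause φ ≠ ⊤) {M M' : ℕ}
    (hM : 1 ≤ M) (hM' : 1 ≤ M') (X Z : ℕ → Fin d → ℝ) (hX : ∀ m, X m ∈ unitCube d)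
    (hZ : ∀ m, Z m ∈ unitCube d) {δ : ℝ}
    (hδ : ∀ s ∈ unitCube d,
      |(((Finset.range M).filter fun m => ∀ j, X m j ≤ s j).card : ℝ) / M
        - (((Finset.range M').filter fun m => ∀ j, Z m j ≤ s j).card : ℝ) / M'| ≤ δ) :
    |mean M φ X - mean M' φ Z| ≤ δ * (hardyKrause φ).toReal := by
  let F : Finset ℝ := insert 1
    (((Finset.range M ×ˢ (Finset.univ : Finset (Fin d))).image fun q => X q.1 q.2)
      ∪ ((Finset.range M' ×ˢ (Finset.univ : Finset (Fin d))).image fun q => Z q.1 q.2))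
  have hXF : ∀ m ∈ Finset.range M, ∀ j, X m j ∈ F := fun m hm j =>
    Finset.mem_insert_of_mem (Finset.mem_union_left _
      (Finset.mem_image.2 ⟨(m, j), Finset.mem_product.2 ⟨hm, Finset.mem_univ _⟩, rfl⟩))
  have hZF : ∀ m ∈ Finset.range M', ∀ j, Z m j ∈ F := fun m hm j =>
    Finset.mem_insert_of_mem (Finset.mem_union_right _
      (Finset.mem_image.2 ⟨(m, j), Finset.mem_product.2 ⟨hm, Finset.mem_univ _⟩, rfl⟩))
  obtain ⟨n, p, κ, hmono, hp01, hpn, hκ⟩ := exists_grid F (by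
    intro x hx
    rcases Finset.mem_insert.1 hx with rfl | hx
    · simp
    rcases Finset.mem_union.1 hx with hx | hx
    · obtain ⟨q, _, rfl⟩ := Finset.mem_image.1 hx
      exact ⟨(hX q.1).1 q.2, (hX q.1).2 q.2⟩
    · obtain ⟨q, _, rfl⟩ := Finset.mem_image.1 hx
      exact ⟨(hZ q.1).1 q.2, (hZ q.1).2 q.2⟩) (Finset.mem_insert_self _ _)
  let G : Finset (Fin d) → Finset (Fin d → ℕ) := fun u =>
    Fintype.piFinset fun i => if i ∈ u then Finset.range n else {0}
  let Δ : Finset (Fin d) → (Fin d → ℕ) → ℝ := fun u c =>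
    boxDifference φ u (fun i => p (c i)) (fun i => p (c i + 1))
  -- the corner of the anchored box attached to the cell `c` of the face `u`
  let s : Finset (Fin d) → (Fin d → ℕ) → Fin d → ℝ := fun u c i => if i ∈ u then p (c i) else 1
  have hs : ∀ u c, s u c ∈ unitCube d := fun u c => by
    constructor <;> intro i <;> simp only [s] <;> split_ifs
    · exact (hp01 _).1
    · exact zero_le_one
    · exact (hp01 _).2
    · exact le_rfl
  have hmean : ∀ (N : ℕ) (Y : ℕ → Fin d → ℝ), (∀ m, Y m ∈ unitCube d) →
      (∀ m ∈ Finset.range N, ∀ j, Y m j ∈ F) →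
      mean N φ Y = ∑ u, ∑ c ∈ G u, (-1) ^ u.card *
        ((((Finset.range N).filter fun m => ∀ j, Y m j ≤ s u c j).card : ℝ) / N) * Δ u c := by
    intro N Y hY01 hY
    have hpt : ∀ m ∈ Finset.range N, φ (Y m) = ∑ u, ∑ c ∈ G u,
        (-1) ^ u.card * (if ∀ j, Y m j ≤ s u c j then 1 else 0) * Δ u c := by
      intro m hm
      have h := eq_sum_boxDifference φ p n hpn (fun i => κ (Y m i))
        fun i => (hκ _ (hY m hm i)).1
      simp only [(hκ _ (hY m hm _)).2.1] at h
      refine h.trans (Finset.sum_congr rfl fun u _ => Finset.sum_congr rfl fun c hc => ?_)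
      congr 1
      rw [Finset.prod_ite_zero, Finset.prod_const]
      have hiff : (∀ i ∈ u, κ (Y m i) ≤ c i) ↔ ∀ j, Y m j ≤ s u c j := by
        refine forall_congr' fun i => ?_
        by_cases hi : i ∈ u
        · have hci := Fintype.mem_piFinset.1 hc i
          rw [if_pos hi, Finset.mem_range] at hci
          simp only [hi, s, if_true, true_imp_iff]
          exact (hκ _ (hY m hm i)).2.2 _ hci
        · have h1 : Y m i ≤ 1 := (hY01 m).2 i
          simpa only [hi, s, if_false, false_imp_iff, true_iff] using h1
      simp only [hiff]
      split_ifs <;> simp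
    rw [mean, Finset.sum_congr rfl hpt, Finset.sum_comm, Finset.sum_div]
    refine Finset.sum_congr rfl fun u _ => ?_
    rw [Finset.sum_comm, Finset.sum_div]
    refine Finset.sum_congr rfl fun c _ => ?_
    rw [← Finset.sum_mul, ← Finset.mul_sum, Finset.card_filter]
    push_cast
    ring
  -- the term of the empty face is `φ (1, …, 1)` for both means and cancels
  have hδ0 : 0 ≤ δ := (abs_nonneg _).trans (hδ _ (hs ∅ 0))
  have hempty : ∀ (N : ℕ) (Y : ℕ → Fin d → ℝ), 1 ≤ N → (∀ m, Y m ∈ unitCube d) → ∀ c,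
      (((Finset.range N).filter fun m => ∀ j, Y m j ≤ s ∅ c j).card : ℝ) / N = 1 := by
    intro N Y hN hY c
    rw [Finset.filter_true_of_mem fun m _ j => by simpa [s] using (hY m).2 j, Finset.card_range,
      div_self]
    exact_mod_cast (by omega : N ≠ 0)
  have hbound : |mean M φ X - mean M' φ Z|
      ≤ ∑ u ∈ (Finset.univ : Finset (Fin d)).powerset.erase ∅, ∑ c ∈ G u, δ * |Δ u c| := by
    rw [hmean M X hX hXF, hmean M' Z hZ hZF, ← Finset.sum_sub_distrib, Finset.powerset_univ,
      ← Finset.add_sum_erase _ _ (Finset.mem_univ ∅)]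
    simp only [hempty M X hM hX, hempty M' Z hM' hZ, sub_self, zero_add]
    refine (Finset.abs_sum_le_sum_abs _ _).trans (Finset.sum_le_sum fun u _ => ?_)
    rw [← Finset.sum_sub_distrib]
    refine (Finset.abs_sum_le_sum_abs _ _).trans (Finset.sum_le_sum fun c _ => ?_)
    rw [← sub_mul, ← mul_sub, abs_mul, abs_mul, abs_pow, abs_neg, abs_one, one_pow, one_mul]
    exact mul_le_mul_of_nonneg_right (hδ _ (hs u c)) (abs_nonneg _)
  refine hbound.trans ?_
  simp only [← Finset.mul_sum]
  refine mul_le_mul_of_nonneg_left ?_ hδ0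
  rw [← ENNReal.ofReal_le_iff_le_toReal hφ, ENNReal.ofReal_sum_of_nonneg
    fun u _ => Finset.sum_nonneg fun c _ => abs_nonneg _]
  refine Finset.sum_le_sum fun u _ => ?_
  rw [ENNReal.ofReal_sum_of_nonneg fun c _ => abs_nonneg _]
  exact le_iSup₂ (f := fun (n : ℕ)
    (p : {p : Fin d → ℕ → ℝ // ∀ i, Monotone (p i) ∧ ∀ j, p i j ∈ Set.Icc (0 : ℝ) 1}) =>
    ∑ c ∈ Fintype.piFinset fun i => if i ∈ u then Finset.range n else {0},
      ENNReal.ofReal |boxDifference φ u (fun i => p.1 i (c i)) (fun i => p.1 i (c i + 1))|)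
    n ⟨fun _ => p, fun _ => ⟨hmono, hp01⟩⟩

/-! ### Scrambled points are uniformly distributed -/

lemma IsUniformBits.precomp {ι κ Ω : Type*} [MeasurableSpace Ω] {P : Measure Ω}
    {ξ : ι → Ω → ZMod 2} (h : IsUniformBits P ξ) {e : κ → ι} (he : Function.Injective e) :
    IsUniformBits P fun k => ξ (e k) :=
  ⟨fun k => h.1 (e k), fun k => h.2.1 (e k), h.2.2.precomp he⟩

lemma measurable_scramble {d : ℕ} (a : Fin d → ℕ → ZMod 2) (j : Fin d) (b : ℕ) :
    Measurable fun π : ScrambleIndex d → ZMod 2 => scramble π a j b :=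
  (measurable_of_countable fun x : ZMod 2 => a j b + x).comp (measurable_pi_apply _)

lemma measurable_ofDigits_scramble {d : ℕ} (a : Fin d → ℕ → ZMod 2) :
    Measurable fun π : ScrambleIndex d → ZMod 2 => ofDigits (scramble π a) :=
  measurable_pi_lambda _ fun j => Measurable.tsum fun b =>
    ((measurable_of_countable fun x : ZMod 2 => (x.val : ℝ)).comp
      (measurable_scramble a j b)).div_const _

lemma SobolSequence.measurable_scrambledPoint {d : ℕ} (S : SobolSequence d) (n : ℕ) :
    Measurable fun π => S.scrambledPoint π n :=
  measurable_ofDigits_scramble _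

lemma SobolSequence.scrambledPoint_mem_unitCube {d : ℕ} (S : SobolSequence d)
    (π : ScrambleIndex d → ZMod 2) (n : ℕ) : S.scrambledPoint π n ∈ unitCube d :=
  ofDigits_mem_unitCube _

lemma measurableSet_unitCube (d : ℕ) : MeasurableSet (unitCube d) := measurableSet_Icc

lemma volume_restrict_unitCube (d : ℕ) :
    (volume : Measure (Fin d → ℝ)).restrict (unitCube d)
      = Measure.pi fun _ => (volume : Measure ℝ).restrict (Set.Icc 0 1) := by
  rw [← Measure.restrict_pi_pi, ← volume_pi, unitCube, ← Set.pi_univ_Icc]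
  rfl

instance isProbabilityMeasure_restrict_unitCube (d : ℕ) :
    IsProbabilityMeasure ((volume : Measure (Fin d → ℝ)).restrict (unitCube d)) := by
  have : IsProbabilityMeasure ((volume : Measure ℝ).restrict (Set.Icc 0 1)) := ⟨by simp⟩
  rw [volume_restrict_unitCube]
  infer_instance

section

variable {d : ℕ} {Ω : Type*} [MeasurableSpace Ω] {P : Measure Ω}
  {ξ : ScrambleIndex d → Ω → ZMod 2}

/-- Distinct digits of a fixed digit array are scrambled by distinct random bits. -/
lemma measureReal_inCell_scramble (h : IsUniformBits P ξ) (a : Fin d → ℕ → ZMod 2)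
    (l : Fin d → ℕ) (z : Fin d → ℕ → ZMod 2) :
    P.real {ω | InCell l z (scramble (fun i => ξ i ω) a)} = 1 / 2 ^ (∑ j, l j) := by
  let e : (Σ _ : Fin d, ℕ) → ScrambleIndex d := fun r => (r.1, (List.range r.2).map (a r.1))
  have he : Function.Injective e := by
    rintro ⟨j, b⟩ ⟨j', b'⟩ h
    have h1 := congrArg Prod.fst h
    have h2 := congrArg (fun q => List.length q.2) h
    simp [e] at h1 h2
    rw [h1, h2]
  have hset : {ω | InCell l z (scramble (fun i => ξ i ω) a)}
      = ⋂ r ∈ Finset.univ.sigma fun j => Finset.range (l j),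
        ξ (e r) ⁻¹' {z r.1 r.2 - a r.1 r.2} := by
    ext ω
    simp only [Set.mem_ofPred_eq, InCell, scramble, Set.mem_iInter, Finset.mem_sigma,
      Finset.mem_univ, true_and, Finset.mem_range, Set.mem_preimage, Set.mem_singleton_iff, e,
      Sigma.forall]
    refine forall_congr' fun j => forall₂_congr fun b _ => ?_
    rw [eq_sub_iff_add_eq, add_comm]
  have h1 := (h.precomp he).2.2.measure_inter_preimage_eq_mul
    (Finset.univ.sigma fun j => Finset.range (l j))
    (sets := fun r => {z r.1 r.2 - a r.1 r.2}) fun _ _ => measurableSet_singleton _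
  have h2 : ∀ r : (Σ _ : Fin d, ℕ), P (ξ (e r) ⁻¹' {z r.1 r.2 - a r.1 r.2}) = 1 / 2 :=
    fun r => h.2.1 (e r) _
  rw [hset, Measure.real, h1, Finset.prod_congr rfl fun r _ => h2 r, Finset.prod_const,
    Finset.card_sigma]
  simp

variable [IsProbabilityMeasure P]

lemma measureReal_box_scramble (h : IsUniformBits P ξ) (a : Fin d → ℕ → ZMod 2)
    (s : Fin d → ℝ) (hs : s ∈ unitCube d) (B : Set Ω)
    (hB1 : ∀ ω, (∀ j, ofDigits (scramble (fun i => ξ i ω) a) j < s j) → ω ∈ B)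
    (hB2 : ∀ ω ∈ B, ∀ j, ofDigits (scramble (fun i => ξ i ω) a) j ≤ s j) :
    P.real B = ∏ j, s j := by
  have hmeas : ∀ j b, Measurable fun ω => scramble (fun i => ξ i ω) a j b := fun j b =>
    (measurable_scramble a j b).comp (measurable_pi_lambda _ h.1)
  have hr : ∀ r : ℕ, |P.real B - ∏ j, s j| ≤ d / 2 ^ r := fun r => by
    have := abs_measureReal_box_sub_le (δ := 0) hmeas
      (fun l z => by rw [measureReal_inCell_scramble h, sub_self, abs_zero]) r s hs B hB1 hB2
    simpa using this
  have hlim : Tendsto (fun r : ℕ => (d : ℝ) / 2 ^ r) atTop (𝓝 0) :=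
    tendsto_const_nhds.div_atTop (tendsto_pow_atTop_atTop_of_one_lt one_lt_two)
  have := ge_of_tendsto' hlim hr
  exact sub_eq_zero.1 (abs_eq_zero.1 (le_antisymm this (abs_nonneg _)))

lemma volume_Iio_inter_Icc (r : ℝ) :
    (volume : Measure ℝ) (Set.Iio r ∩ Set.Icc 0 1) = ENNReal.ofReal (max 0 (min r 1)) := by
  rcases le_or_gt r 1 with h | h
  · have : Set.Iio r ∩ Set.Icc 0 1 = Set.Ico 0 r := by
      ext x
      simp only [Set.mem_inter_iff, Set.mem_Iio, Set.mem_Icc, Set.mem_Ico]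
      exact ⟨fun hx => ⟨hx.2.1, hx.1⟩, fun hx => ⟨hx.2, hx.1, hx.2.le.trans h⟩⟩
    rw [this, Real.volume_Ico, sub_zero, min_eq_left h]
    rcases le_total r 0 with h0 | h0
    · rw [max_eq_left h0, ENNReal.ofReal_of_nonpos h0, ENNReal.ofReal_zero]
    · rw [max_eq_right h0]
  · have : Set.Iio r ∩ Set.Icc 0 1 = Set.Icc 0 1 :=
      Set.inter_eq_right.2 fun x hx => lt_of_le_of_lt hx.2 h
    rw [this, Real.volume_Icc, sub_zero, min_eq_right h.le, max_eq_right zero_le_one]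

/-- A nested uniform scrambling of any point is uniformly distributed on the unit cube. -/
lemma map_ofDigits_scramble (h : IsUniformBits P ξ) (a : Fin d → ℕ → ZMod 2) :
    P.map (fun ω => ofDigits (scramble (fun i => ξ i ω) a)) = volume.restrict (unitCube d) := by
  have hmeas : Measurable fun ω => ofDigits (scramble (fun i => ξ i ω) a) :=
    (measurable_ofDigits_scramble a).comp (measurable_pi_lambda _ h.1)
  rw [volume_restrict_unitCube]
  symm
  refine Measure.pi_eq_generateFrom (C := fun _ => Set.range Set.Iio)
    (fun _ => (borel_eq_generateFrom_Iio ℝ).symm.trans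
      (BorelSpace.measurable_eq (α := ℝ)).symm) (fun _ => isPiSystem_Iio)
    (fun _ => ⟨fun n => Set.Iio n, fun n => ⟨n, rfl⟩, fun n => measure_lt_top _ _,
      Set.iUnion_eq_univ_iff.2 fun x => exists_nat_gt x⟩) fun t ht => ?_
  choose r hr using ht
  obtain rfl : (fun i => Set.Iio (r i)) = t := funext hr
  have hs : (fun j => max 0 (min (r j) 1)) ∈ unitCube d :=
    ⟨fun j => le_max_left _ _, fun j => max_le zero_le_one (min_le_right _ _)⟩
  have hB := measureReal_box_scramble h a _ hs
    ((fun ω => ofDigits (scramble (fun i => ξ i ω) a)) ⁻¹' Set.univ.pi fun i => Set.Iio (r i))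
    (fun ω hω j _ => by
      have h1 := hω j
      have h0 : 0 ≤ ofDigits (scramble (fun i => ξ i ω) a) j := (ofDigits_mem_unitCube _).1 j
      rcases lt_max_iff.1 h1 with h2 | h2
      · exact absurd h2 (not_lt.2 h0)
      · exact h2.trans_le (min_le_left _ _))
    (fun ω hω j => le_max_of_le_right
      (le_min (hω j trivial).le ((ofDigits_mem_unitCube _).2 j)))
  rw [Measure.map_apply hmeas (MeasurableSet.univ_pi fun i => measurableSet_Iio),
    ← ENNReal.ofReal_toReal (measure_ne_top P _), ← Measure.real, hB,
    ENNReal.ofReal_prod_of_nonneg fun j _ => le_max_left _ _]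
  refine Finset.prod_congr rfl fun j _ => ?_
  rw [Measure.restrict_apply measurableSet_Iio, volume_Iio_inter_Icc]

end

/-- A function of finite variation is bounded: compare its means over two one-point sets. -/
lemma integrableOn_of_hardyKrause_ne_top {d : ℕ} {φ : (Fin d → ℝ) → ℝ}
    (hm : Measurable φ) (hφ : hardyKrause φ ≠ ⊤) : IntegrableOn φ (unitCube d) := by
  classical
  have hone : (1 : Fin d → ℝ) ∈ unitCube d := ⟨fun _ => zero_le_one, le_refl _⟩
  refine Integrable.of_bound hm.aestronglyMeasurable ((hardyKrause φ).toReal + |φ 1|)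
    (ae_restrict_of_forall_mem (measurableSet_unitCube d) fun x hx => ?_)
  have h := abs_mean_sub_mean_le φ hφ le_rfl le_rfl (fun _ => x) (fun _ => 1) (fun _ => hx)
    (fun _ => hone) (δ := 1) (fun s hs => by
      simp only [Finset.range_one, Finset.filter_singleton]
      split_ifs <;> simp)
  simp only [mean, Finset.range_one, Finset.sum_singleton, Nat.cast_one, div_one, one_mul] at h
  rw [Real.norm_eq_abs]
  have := abs_sub_abs_le_abs_sub (φ x) (φ 1)
  linarith

namespace SobolSequence

variable {d : ℕ} (S : SobolSequence d) {Ω : Type*} [MeasurableSpace Ω] {P : Measure Ω}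
  {ξ : ScrambleIndex d → Ω → ZMod 2}

lemma measurable_scrambledPoint_comp (h : IsUniformBits P ξ) (n : ℕ) :
    Measurable fun ω => S.scrambledPoint (fun i => ξ i ω) n :=
  (S.measurable_scrambledPoint n).comp (measurable_pi_lambda _ h.1)

variable [IsProbabilityMeasure P]

lemma map_scrambledPoint (h : IsUniformBits P ξ) (n : ℕ) :
    P.map (fun ω => S.scrambledPoint (fun i => ξ i ω) n) = volume.restrict (unitCube d) :=
  map_ofDigits_scramble h _

lemma integral_comp_scrambledPoint (h : IsUniformBits P ξ) (n : ℕ) {φ : (Fin d → ℝ) → ℝ}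
    (hφ : IntegrableOn φ (unitCube d)) :
    ∫ ω, φ (S.scrambledPoint (fun i => ξ i ω) n) ∂P = ∫ x in unitCube d, φ x := by
  rw [← S.map_scrambledPoint h n, integral_map (S.measurable_scrambledPoint_comp h n).aemeasurable]
  rw [S.map_scrambledPoint h n]
  exact hφ.aestronglyMeasurable

lemma integrable_comp_scrambledPoint (h : IsUniformBits P ξ) (n : ℕ) {φ : (Fin d → ℝ) → ℝ}
    (hφ : IntegrableOn φ (unitCube d)) :
    Integrable (fun ω => φ (S.scrambledPoint (fun i => ξ i ω) n)) P := by
  have h1 := S.map_scrambledPoint h n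
  rw [IntegrableOn, ← h1] at hφ
  exact hφ.comp_measurable (S.measurable_scrambledPoint_comp h n)

lemma integrable_mean_scrambledPoint (h : IsUniformBits P ξ) (N : ℕ) {φ : (Fin d → ℝ) → ℝ}
    (hφ : IntegrableOn φ (unitCube d)) :
    Integrable (fun ω => mean N φ (S.scrambledPoint fun i => ξ i ω)) P :=
  (integrable_finsetSum _ fun n _ => S.integrable_comp_scrambledPoint h n hφ).div_const _

/-- A mean over scrambled points is an unbiased estimator of the integral. -/
lemma integral_mean_scrambledPoint (h : IsUniformBits P ξ) {N : ℕ} (hN : 1 ≤ N)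
    {φ : (Fin d → ℝ) → ℝ} (hφ : IntegrableOn φ (unitCube d)) :
    ∫ ω, mean N φ (S.scrambledPoint fun i => ξ i ω) ∂P = ∫ x in unitCube d, φ x := by
  simp only [mean]
  rw [integral_div, integral_finsetSum _ fun n _ => S.integrable_comp_scrambledPoint h n hφ,
    Finset.sum_congr rfl fun n _ => S.integral_comp_scrambledPoint h n hφ, Finset.sum_const,
    Finset.card_range, nsmul_eq_mul, mul_div_cancel_left₀]
  exact_mod_cast (by omega : N ≠ 0)

/-- Error bound for integration with scrambled Sobol' points. The integral is the expectation of
the mean over a second, random scrambling; both point sets have small discrepancy, and the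
Koksma--Hlawka inequality for two finite point sets applies. -/
lemma abs_mean_scrambledPoint_sub_integral_le (h : IsUniformBits P ξ) {M : ℕ} (hM : 1 ≤ M)
    {φ : (Fin d → ℝ) → ℝ} (hm : Measurable φ) (hφ : hardyKrause φ ≠ ⊤)
    (π : ScrambleIndex d → ZMod 2) :
    |mean M φ (S.scrambledPoint π) - ∫ x in unitCube d, φ x|
      ≤ 2 * S.discBound M * (hardyKrause φ).toReal := by
  classical
  have hint := integrableOn_of_hardyKrause_ne_top hm hφ
  have hpt : ∀ π', |mean M φ (S.scrambledPoint π) - mean M φ (S.scrambledPoint π')|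
      ≤ 2 * S.discBound M * (hardyKrause φ).toReal := by
    intro π'
    refine abs_mean_sub_mean_le φ hφ hM hM _ _ (S.scrambledPoint_mem_unitCube π)
      (S.scrambledPoint_mem_unitCube π') fun s hs => ?_
    have h1 := S.abs_card_box_sub_le π M hM s hs {x | ∀ j, x j ≤ s j}
      (fun x _ hx j => (hx j).le) (fun x _ hx => hx)
    have h2 := S.abs_card_box_sub_le π' M hM s hs {x | ∀ j, x j ≤ s j}
      (fun x _ hx j => (hx j).le) (fun x _ hx => hx)
    simp only [Set.mem_ofPred_eq] at h1 h2
    rw [abs_le] at h1 h2 ⊢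
    constructor <;> linarith [h1.1, h1.2, h2.1, h2.2]
  rw [← S.integral_mean_scrambledPoint h hM hint]
  have h3 : mean M φ (S.scrambledPoint π)
      - ∫ ω, mean M φ (S.scrambledPoint fun i => ξ i ω) ∂P
      = ∫ ω, (mean M φ (S.scrambledPoint π)
        - mean M φ (S.scrambledPoint fun i => ξ i ω)) ∂P := by
    rw [integral_sub (integrable_const _) (S.integrable_mean_scrambledPoint h M hint)]
    simp
  rw [h3, ← Real.norm_eq_abs]
  exact (norm_integral_le_of_norm_le_const (C := 2 * S.discBound M * (hardyKrause φ).toReal)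
    (Eventually.of_forall fun ω => hpt _)).trans_eq (by simp)

end SobolSequence

/-- The two parts of a family of independent uniform bits are independent. -/
lemma IsUniformBits.indepFun_sum {ι κ Ω : Type*} [MeasurableSpace Ω] {P : Measure Ω}
    {A : ι → Ω → ZMod 2} {B : κ → Ω → ZMod 2} (h : IsUniformBits P (Sum.elim A B)) :
    IndepFun (fun ω i => A i ω) (fun ω i => B i ω) P := by
  rw [IndepFun_iff_Indep]
  have h1 := indep_iSup_of_disjoint (fun i => (h.1 i).comap_le)
    ((iIndepFun_iff_iIndep _ _ _).1 h.2.2)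
    (Set.isCompl_range_inl_range_inr (α := ι) (β := κ)).disjoint
  rw [iSup_range, iSup_range] at h1
  simpa only [MeasurableSpace.pi, MeasurableSpace.comap_iSup, MeasurableSpace.comap_comp,
    Function.comp_def, Sum.elim_inl, Sum.elim_inr] using h1

/-! ### Constants of the discrepancy bounds -/

namespace SobolSequence

variable {d : ℕ} (S : SobolSequence d)

lemma discBound_nonneg (M : ℕ) : 0 ≤ S.discBound M := by
  unfold discBound
  positivity

/-- The constant `C ε` in the discrepancy bound `C ε * M ^ (-1 + ε)`. The base of the power comes
from `log M ≤ M ^ δ / δ` with `δ = ε / (d + 1)`. The factor `2` is the one lost in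
`abs_mean_scrambledPoint_sub_integral_le`. -/
noncomputable def discConst (ε : ℝ) : ℝ :=
  2 * (2 ^ S.degreeSum + d) * ((d + 1) / (ε * Real.log 2) + 2) ^ (d + 1)

lemma discConst_pos {ε : ℝ} (hε : 0 < ε) : 0 < S.discConst ε := by
  have := Real.log_pos one_lt_two
  unfold discConst
  positivity

lemma tendsto_discConst : Tendsto S.discConst (𝓝[>] 0) atTop := by
  refine tendsto_atTop_mono' _ ?_ tendsto_inv_nhdsGT_zero
  filter_upwards [self_mem_nhdsWithin] with ε hε
  have hε : 0 < ε := hε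
  have hl := Real.log_pos one_lt_two
  have hl2 : Real.log 2 ≤ 1 := (Real.log_le_sub_one_of_pos two_pos).trans (by norm_num)
  have h1 : ε⁻¹ ≤ (d + 1) / (ε * Real.log 2) + 2 := by
    have : ε⁻¹ ≤ (d + 1) / (ε * Real.log 2) := by
      rw [← one_div]
      refine div_le_div₀ (by positivity) (by simp) (by positivity) ?_
      exact mul_le_of_le_one_right hε.le hl2
    linarith
  have h2 : (1 : ℝ) ≤ (d + 1) / (ε * Real.log 2) + 2 := by
    have : 0 ≤ (d + 1) / (ε * Real.log 2) := by positivity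
    linarith
  have h3 : (1 : ℝ) ≤ 2 * (2 ^ S.degreeSum + d) := by
    have : (1 : ℝ) ≤ 2 ^ S.degreeSum := one_le_pow₀ one_le_two
    linarith [Nat.cast_nonneg (α := ℝ) d]
  calc ε⁻¹ ≤ (d + 1) / (ε * Real.log 2) + 2 := h1
    _ ≤ ((d + 1) / (ε * Real.log 2) + 2) ^ (d + 1) := le_self_pow₀ h2 (by omega)
    _ ≤ _ := le_mul_of_one_le_left (by positivity) h3

lemma two_mul_discBound_le {ε : ℝ} (hε : 0 < ε) {M : ℕ} (hM : 1 ≤ M) :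
    2 * S.discBound M ≤ S.discConst ε / (M : ℝ) ^ (1 - ε) := by
  have hl := Real.log_pos one_lt_two
  have hM1 : (1 : ℝ) ≤ M := by exact_mod_cast hM
  have hM0 : (0 : ℝ) < M := by linarith
  set δ : ℝ := ε / (d + 1) with hδ
  have hδ0 : 0 < δ := by positivity
  have h1 : (Nat.log 2 M : ℝ) ≤ M ^ δ / δ / Real.log 2 := by
    rw [le_div_iff₀ hl, ← Real.log_pow]
    refine le_trans (Real.log_le_log (by positivity) ?_) (Real.log_le_rpow_div hM0.le hδ0)
    exact_mod_cast Nat.pow_log_le_self 2 (by omega)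
  have h2 : (1 : ℝ) ≤ M ^ δ := Real.one_le_rpow hM1 hδ0.le
  have h3 : (Nat.log 2 M : ℝ) + 2 ≤ ((d + 1) / (ε * Real.log 2) + 2) * M ^ δ := by
    have e : (M : ℝ) ^ δ / δ / Real.log 2 = (d + 1) / (ε * Real.log 2) * M ^ δ := by
      rw [hδ]
      field_simp
    rw [e] at h1
    rw [add_mul]
    linarith
  have h4 : ((M : ℝ) ^ δ) ^ (d + 1) = M ^ ε := by
    rw [← Real.rpow_mul_natCast hM0.le, hδ]
    congr 1
    push_cast
    field_simp
  have h5 : ((Nat.log 2 M : ℝ) + 2) ^ (d + 1)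
      ≤ ((d + 1) / (ε * Real.log 2) + 2) ^ (d + 1) * M ^ ε := by
    rw [← h4, ← mul_pow]
    gcongr
  have h6 : S.discConst ε / (M : ℝ) ^ (1 - ε) = S.discConst ε * M ^ ε / M := by
    rw [Real.rpow_sub hM0, Real.rpow_one]
    field_simp
  rw [h6, discConst, discBound, ← mul_div_assoc]
  gcongr ?_ / _
  calc 2 * ((2 ^ S.degreeSum + d) * ((Nat.log 2 M : ℝ) + 2) ^ (d + 1))
      ≤ 2 * ((2 ^ S.degreeSum + d)
          * (((d + 1) / (ε * Real.log 2) + 2) ^ (d + 1) * M ^ ε)) := by gcongr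
    _ = _ := by ring

lemma starDiscrepancy_scrambledPoint_le_discConst (π : ScrambleIndex d → ZMod 2) {ε : ℝ}
    (hε : 0 < ε) {M : ℕ} (hM : 1 ≤ M) :
    starDiscrepancy M (S.scrambledPoint π) ≤ S.discConst ε / (M : ℝ) ^ (1 - ε) := by
  have h1 := S.starDiscrepancy_scrambledPoint_le π M hM
  have h2 := S.two_mul_discBound_le hε hM
  have h3 := S.discBound_nonneg M
  linarith

end SobolSequence

/-! ### Third-order Taylor expansion -/

lemma abs_sub_sub_deriv_mul_le {f : ℝ → ℝ} {U : Set ℝ} (hU : IsOpen U) (hf : ContDiffOn ℝ 3 f U)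
    {a b B : ℝ} (hseg : Set.uIcc b a ⊆ U)
    (hB : ∀ z ∈ Set.uIcc b a, |iteratedDeriv 3 f z| ≤ B) :
    |f a - f b - deriv f b * (a - b)|
      ≤ |iteratedDeriv 2 f b| * |a - b| ^ 2 / 2 + B * |a - b| ^ 3 / 6 := by
  rcases eq_or_ne b a with rfl | hne
  · simp
  have hb : b ∈ Set.uIcc b a := Set.left_mem_uIcc
  have hfb : ContDiffAt ℝ 3 f b := hf.contDiffAt (hU.mem_nhds (hseg hb))
  have huniq : UniqueDiffOn ℝ (Set.uIcc b a) := uniqueDiffOn_Icc (by simpa using hne.symm)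
  obtain ⟨z, hz, hT⟩ := taylor_mean_remainder_lagrange_iteratedDeriv (n := 2) hne
    (by exact_mod_cast hf.mono hseg)
  have e1 : iteratedDerivWithin 1 f (Set.uIcc b a) b = deriv f b := by
    rw [iteratedDerivWithin_eq_iteratedDeriv huniq (hfb.of_le (by norm_num)) hb, iteratedDeriv_one]
  have e2 : iteratedDerivWithin 2 f (Set.uIcc b a) b = iteratedDeriv 2 f b :=
    iteratedDerivWithin_eq_iteratedDeriv huniq (hfb.of_le (by norm_num)) hb
  rw [taylorWithinEval_succ, taylorWithinEval_succ, taylor_within_zero_eval, zero_add,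
    show 1 + 1 = 2 from rfl, e1, e2] at hT
  have h1 : f a - f b - deriv f b * (a - b)
      = iteratedDeriv 2 f b * (a - b) ^ 2 / 2 + iteratedDeriv 3 f z * (a - b) ^ 3 / 6 := by
    norm_num [Nat.factorial] at hT
    linear_combination hT
  rw [h1]
  refine (abs_add_le _ _).trans (add_le_add (le_of_eq ?_) ?_)
  · rw [abs_div, abs_mul, abs_pow, abs_of_pos (two_pos : (0 : ℝ) < 2)]
  · rw [abs_div, abs_mul, abs_pow, abs_of_pos (by norm_num : (0 : ℝ) < 6)]
    gcongr
    exact hB z (Set.uIoo_subset_uIcc_self hz)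

/-- The monotonicity of `|f'''|` and the constant sign of the values `b y` make it possible to
bound the Taylor remainders at all `b y` by `f'''` at a common multiple `K * b y`: `K` is one of
`1 + θ` and `1 - θ`. -/
lemma exists_common_multiple {E : Type*} {F : ℝ → ℝ} {U : Set ℝ}
    (hF : MonotoneOn F U ∨ AntitoneOn F U) {D : Set E} {b : E → ℝ}
    (hb : (∀ y ∈ D, 0 < b y) ∨ (∀ y ∈ D, b y < 0))
    (hU : ∀ K ∈ Set.Ioo (0 : ℝ) 2, ∀ y ∈ D, K * b y ∈ U) {θ : ℝ} (h0 : 0 < θ) (h1 : θ < 1) :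
    ∃ K : ℝ, 0 < K ∧ K < 2 ∧ ∀ y ∈ D, ∀ z, |z - b y| ≤ θ * |b y| → z ∈ U ∧ F z ≤ F (K * b y) := by
  have hmem : ∀ y ∈ D, ∀ z, |z - b y| ≤ θ * |b y| → z ∈ U := by
    intro y hy z hz
    have hne : b y ≠ 0 := by
      rcases hb with hb | hb
      · exact (hb y hy).ne'
      · exact (hb y hy).ne
    -- `z` is a multiple of `b y` with factor in `[1 - θ, 1 + θ] ⊆ (0, 2)`
    have h2 : z = z / b y * b y := by field_simp
    have h3 : |z / b y - 1| ≤ θ := by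
      have : z / b y - 1 = (z - b y) / b y := by field_simp
      rw [this, abs_div, div_le_iff₀ (abs_pos.2 hne)]
      exact hz
    rw [h2]
    rw [abs_le] at h3
    exact hU _ ⟨by linarith, by linarith⟩ y hy
  have hup : (1 + θ) ∈ Set.Ioo (0 : ℝ) 2 := ⟨by linarith, by linarith⟩
  have hlo : (1 - θ) ∈ Set.Ioo (0 : ℝ) 2 := ⟨by linarith, by linarith⟩
  have hpos : (∀ y ∈ D, 0 < b y) → ∀ y ∈ D, ∀ z, |z - b y| ≤ θ * |b y| →
      z ≤ (1 + θ) * b y ∧ (1 - θ) * b y ≤ z := by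
    intro hb y hy z hz
    rw [abs_of_pos (hb y hy), abs_le] at hz
    constructor <;> linarith
  have hneg : (∀ y ∈ D, b y < 0) → ∀ y ∈ D, ∀ z, |z - b y| ≤ θ * |b y| →
      z ≤ (1 - θ) * b y ∧ (1 + θ) * b y ≤ z := by
    intro hb y hy z hz
    rw [abs_of_neg (hb y hy), abs_le] at hz
    constructor <;> linarith
  rcases hF with hF | hF <;> rcases hb with hb | hb
  · exact ⟨1 + θ, hup.1, hup.2, fun y hy z hz => ⟨hmem y hy z hz,
      hF (hmem y hy z hz) (hU _ hup y hy) (hpos hb y hy z hz).1⟩⟩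
  · exact ⟨1 - θ, hlo.1, hlo.2, fun y hy z hz => ⟨hmem y hy z hz,
      hF (hmem y hy z hz) (hU _ hlo y hy) (hneg hb y hy z hz).1⟩⟩
  · exact ⟨1 - θ, hlo.1, hlo.2, fun y hy z hz => ⟨hmem y hy z hz,
      hF (hU _ hlo y hy) (hmem y hy z hz) (hpos hb y hy z hz).2⟩⟩
  · exact ⟨1 + θ, hup.1, hup.2, fun y hy z hz => ⟨hmem y hy z hz,
      hF (hU _ hup y hy) (hmem y hy z hz) (hneg hb y hy z hz).2⟩⟩

/-- Taylor expansion under the integral sign for an unbiased random argument `A`: the first-order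
term has mean zero. -/
lemma abs_integral_comp_sub_le {Ω : Type*} [MeasurableSpace Ω] {P : Measure Ω}
    [IsProbabilityMeasure P] {f : ℝ → ℝ} {U : Set ℝ} (hU : IsOpen U) (hf : ContDiffOn ℝ 3 f U)
    {A : Ω → ℝ} {b r B : ℝ} (hA : Integrable A P) (hfA : Integrable (fun ω => f (A ω)) P)
    (hmean : ∫ ω, A ω ∂P = b) (hAr : ∀ ω, |A ω - b| ≤ r)
    (hB : ∀ z, |z - b| ≤ r → z ∈ U ∧ |iteratedDeriv 3 f z| ≤ B) :
    |∫ ω, f (A ω) ∂P - f b| ≤ |iteratedDeriv 2 f b| * r ^ 2 / 2 + B * r ^ 3 / 6 := by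
  have hlin : Integrable (fun ω => deriv f b * (A ω - b)) P :=
    (hA.sub (integrable_const b)).const_mul _
  have hfA' : Integrable (fun ω => f (A ω) - f b) P := hfA.sub (integrable_const _)
  have h1 : ∫ ω, f (A ω) ∂P - f b = ∫ ω, (f (A ω) - f b - deriv f b * (A ω - b)) ∂P := by
    rw [integral_sub hfA' hlin, integral_sub hfA (integrable_const _),
      integral_const_mul, integral_sub hA (integrable_const _), hmean]
    simp
  have hpt : ∀ ω, ‖f (A ω) - f b - deriv f b * (A ω - b)‖
      ≤ |iteratedDeriv 2 f b| * r ^ 2 / 2 + B * r ^ 3 / 6 := by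
    intro ω
    have hz : ∀ z ∈ Set.uIcc b (A ω), |z - b| ≤ r := fun z hz =>
      (Set.abs_sub_left_of_mem_uIcc hz).trans (hAr ω)
    have hB0 : 0 ≤ B := (abs_nonneg _).trans (hB _ (hAr ω)).2
    refine (abs_sub_sub_deriv_mul_le hU hf (B := B) (fun z h => (hB z (hz z h)).1)
      fun z h => (hB z (hz z h)).2).trans ?_
    have := hAr ω
    gcongr
  rw [h1, ← Real.norm_eq_abs]
  exact (norm_integral_le_of_norm_le_const (Eventually.of_forall hpt)).trans_eq (by simp)

/-! ### The nested integral -/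

lemma measurable_innerIntegral {d₁ d₂ : ℕ} {g : (Fin d₁ → ℝ) → (Fin d₂ → ℝ) → ℝ}
    (hg : Measurable (Function.uncurry g)) : Measurable (innerIntegral g) :=
  hg.stronglyMeasurable.integral_prod_right.measurable

lemma restrict_openCube (d : ℕ) :
    (volume : Measure (Fin d → ℝ)).restrict (openCube d) = volume.restrict (unitCube d) :=
  Measure.restrict_congr_set Measure.univ_pi_Ioo_ae_eq_Icc

lemma integrableOn_of_memSobolev {d n : ℕ} {p : ℝ≥0∞} {u : (Fin d → ℝ) → ℝ} (hp : 1 ≤ p)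
    (hu : MemSobolev n p u) : IntegrableOn u (unitCube d) := by
  have h := hu.1
  rw [restrict_openCube] at h
  exact h.integrable hp

lemma measurable_iteratedDeriv_succ (f : ℝ → ℝ) (n : ℕ) : Measurable (iteratedDeriv (n + 1) f) := by
  rw [iteratedDeriv_succ]
  exact measurable_deriv _

section

variable {d₁ d₂ : ℕ} {Ω : Type*} [MeasurableSpace Ω] {P : Measure Ω}

lemma measurable_comp_mean_scrambledPoint (S₂ : SobolSequence d₂) {f : ℝ → ℝ} (hf : Measurable f)
    {g : (Fin d₁ → ℝ) → (Fin d₂ → ℝ) → ℝ} (hg : Measurable (Function.uncurry g)) (M : ℕ) :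
    Measurable fun z : (Fin d₁ → ℝ) × (ScrambleIndex d₂ → ZMod 2) =>
      f (mean M (g z.1) (S₂.scrambledPoint z.2)) := by
  refine hf.comp ((Finset.measurable_fun_sum _ fun m _ => ?_).div_const _)
  exact hg.comp (measurable_fst.prodMk ((S₂.measurable_scrambledPoint m).comp measurable_snd))

variable [IsProbabilityMeasure P]

/-- Replacing `g` by its quasi-Monte Carlo means inside `f` costs at most two moment terms, if the
relative error of the means is at most `θ < 1`. -/
lemma exists_ofReal_abs_integral_comp_mean_sub_le (S₂ : SobolSequence d₂)
    {ρ : ScrambleIndex d₂ → Ω → ZMod 2} (hρ : IsUniformBits P ρ) {f : ℝ → ℝ} {U : Set ℝ}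
    {g : (Fin d₁ → ℝ) → (Fin d₂ → ℝ) → ℝ} (hg : Measurable (Function.uncurry g))
    (hU : IsOpen U) (hf : ContDiffOn ℝ 3 f U)
    (hmono : MonotoneOn (fun z => |iteratedDeriv 3 f z|) U ∨
      AntitoneOn (fun z => |iteratedDeriv 3 f z|) U)
    (hsign : (∀ y ∈ unitCube d₁, 0 < innerIntegral g y) ∨
      (∀ y ∈ unitCube d₁, innerIntegral g y < 0))
    (hKU : ∀ K ∈ Set.Ioo (0 : ℝ) 2, ∀ y ∈ unitCube d₁, K * innerIntegral g y ∈ U)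
    {M : ℕ} (hM : 1 ≤ M)
    (hint : Integrable (fun z : (Fin d₁ → ℝ) × Ω =>
        f (mean M (g z.1) (S₂.scrambledPoint fun i => ρ i z.2)))
      ((volume.restrict (unitCube d₁)).prod P))
    (hfg : IntegrableOn (fun y => f (innerIntegral g y)) (unitCube d₁))
    {k : ℝ} (hk : 0 < k)
    (hHK : ∀ y ∈ unitCube d₁, hardyKrause (g y) ≤ ENNReal.ofReal (k * |innerIntegral g y|))
    {θ : ℝ} (hθ0 : 0 < θ) (hθ1 : θ < 1) (hθ : k * (2 * S₂.discBound M) ≤ θ) :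
    ∃ K : ℝ, 0 < K ∧ K < 2 ∧
      ENNReal.ofReal |(∫ z : (Fin d₁ → ℝ) × Ω,
          f (mean M (g z.1) (S₂.scrambledPoint fun i => ρ i z.2))
            ∂((volume.restrict (unitCube d₁)).prod P)) - nestedIntegral f g|
        ≤ derivMoment f g 2 1 * ENNReal.ofReal (θ ^ 2 / 2)
          + derivMoment f g 3 K * ENNReal.ofReal (θ ^ 3 / 6) := by
  obtain ⟨K, hK0, hK2, hK⟩ := exists_common_multiple hmono hsign hKU hθ0 hθ1
  refine ⟨K, hK0, hK2, ?_⟩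
  let b := innerIntegral g
  have hb : Measurable b := measurable_innerIntegral hg
  let R2 : (Fin d₁ → ℝ) → ℝ := fun y => |b y| ^ 2 * |iteratedDeriv 2 f (1 * b y)|
  let R3 : (Fin d₁ → ℝ) → ℝ := fun y => |b y| ^ 3 * |iteratedDeriv 3 f (K * b y)|
  have hR2 : Measurable R2 :=
    (hb.abs.pow_const 2).mul ((measurable_iteratedDeriv_succ f 1).comp (hb.const_mul 1)).abs
  have hpt : ∀ᵐ y ∂(volume.restrict (unitCube d₁)),
      ‖(∫ ω, f (mean M (g y) (S₂.scrambledPoint fun i => ρ i ω)) ∂P) - f (b y)‖ₑ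
        ≤ ENNReal.ofReal (R2 y) * ENNReal.ofReal (θ ^ 2 / 2)
          + ENNReal.ofReal (R3 y) * ENNReal.ofReal (θ ^ 3 / 6) := by
    filter_upwards [hint.prod_right_ae, ae_restrict_mem (measurableSet_unitCube d₁)] with y hy hyc
    have hgy : Measurable (g y) := hg.of_uncurry_left
    have hV : hardyKrause (g y) ≠ ⊤ := ne_top_of_le_ne_top ENNReal.ofReal_ne_top (hHK y hyc)
    have hV' : (hardyKrause (g y)).toReal ≤ k * |b y| :=
      ENNReal.toReal_le_of_le_ofReal (by positivity) (hHK y hyc)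
    have hgi := integrableOn_of_hardyKrause_ne_top hgy hV
    have hA : ∀ ω, |mean M (g y) (S₂.scrambledPoint fun i => ρ i ω) - b y| ≤ θ * |b y| := by
      intro ω
      refine (S₂.abs_mean_scrambledPoint_sub_integral_le hρ hM hgy hV _).trans ?_
      have h0 := S₂.discBound_nonneg M
      calc 2 * S₂.discBound M * (hardyKrause (g y)).toReal
          ≤ 2 * S₂.discBound M * (k * |b y|) := by gcongr
        _ = k * (2 * S₂.discBound M) * |b y| := by ring
        _ ≤ θ * |b y| := by gcongr
    have h := abs_integral_comp_sub_le (b := b y) hU hf (S₂.integrable_mean_scrambledPoint hρ M hgi) hy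
      (S₂.integral_mean_scrambledPoint hρ hM hgi) hA fun z hz => hK y hyc z hz
    rw [← ENNReal.ofReal_mul (by positivity), ← ENNReal.ofReal_mul (by positivity),
      ← ENNReal.ofReal_add (by positivity) (by positivity), Real.enorm_eq_ofReal_abs]
    refine ENNReal.ofReal_le_ofReal (h.trans (le_of_eq ?_))
    simp only [R2, R3, b, one_mul]
    ring
  have hfub : (∫ z : (Fin d₁ → ℝ) × Ω,
          f (mean M (g z.1) (S₂.scrambledPoint fun i => ρ i z.2))
            ∂((volume.restrict (unitCube d₁)).prod P)) - nestedIntegral f g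
      = ∫ y in unitCube d₁,
          ((∫ ω, f (mean M (g y) (S₂.scrambledPoint fun i => ρ i ω)) ∂P) - f (b y)) := by
    rw [integral_prod _ hint, nestedIntegral]
    exact (integral_sub hint.integral_prod_left hfg).symm
  rw [hfub, ← Real.enorm_eq_ofReal_abs]
  calc _ ≤ ∫⁻ y in unitCube d₁,
          ‖(∫ ω, f (mean M (g y) (S₂.scrambledPoint fun i => ρ i ω)) ∂P) - f (b y)‖ₑ :=
        enorm_integral_le_lintegral_enorm _
    _ ≤ ∫⁻ y in unitCube d₁, (ENNReal.ofReal (R2 y) * ENNReal.ofReal (θ ^ 2 / 2)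
          + ENNReal.ofReal (R3 y) * ENNReal.ofReal (θ ^ 3 / 6)) := lintegral_mono_ae hpt
    _ = _ := by
        rw [lintegral_add_left (hR2.ennreal_ofReal.mul_const _),
          lintegral_mul_const' _ _ ENNReal.ofReal_ne_top,
          lintegral_mul_const' _ _ ENNReal.ofReal_ne_top]
        rfl

/-! ### The expectation of the estimator -/

lemma sum_Ico_one_sub_pred (a : ℕ → ℝ) {L : ℕ} (hL : 1 ≤ L) :
    ∑ ℓ ∈ Finset.Ico 1 L, (a ℓ - a (ℓ - 1)) = a (L - 1) - a 0 := by
  induction L, hL using Nat.le_induction with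
  | base => simp
  | succ L hL ih =>
    rw [Finset.sum_Ico_succ_top hL, ih, Nat.add_sub_cancel]
    ring

/-- A point scrambled by `τ` and an independent scrambling `ρ` are jointly distributed as a uniform
point and `ρ`. -/
lemma map_scrambledPoint_prodMk (S₁ : SobolSequence d₁) {τ : ScrambleIndex d₁ → Ω → ZMod 2}
    {ρ : ScrambleIndex d₂ → Ω → ZMod 2} (h : IsUniformBits P (Sum.elim τ ρ)) (n : ℕ) :
    P.map (fun ω => (S₁.scrambledPoint (fun i => τ i ω) n, fun i => ρ i ω))
      = ((volume.restrict (unitCube d₁)).prod P).map fun z => (z.1, fun i => ρ i z.2) := by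
  have hτ : IsUniformBits P τ := h.precomp (e := Sum.inl) Sum.inl_injective
  have hρ : Measurable fun ω i => ρ i ω := measurable_pi_lambda _ fun i => h.1 (Sum.inr i)
  have hind : IndepFun (fun ω => S₁.scrambledPoint (fun i => τ i ω) n) (fun ω i => ρ i ω) P :=
    h.indepFun_sum.comp (S₁.measurable_scrambledPoint n) measurable_id
  rw [(indepFun_iff_map_prod_eq_prod_map_map
    (S₁.measurable_scrambledPoint_comp hτ n).aemeasurable hρ.aemeasurable).1 hind,
    S₁.map_scrambledPoint hτ]
  have := Measure.map_prod_map (volume.restrict (unitCube d₁)) P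
    (measurable_id (α := Fin d₁ → ℝ)) hρ
  rw [Measure.map_id] at this
  exact this

/-- The level sums of the estimator telescope in expectation: its bias is that of the finest
level. -/
lemma integral_mldlEstimator (S₁ : SobolSequence d₁) (S₂ : SobolSequence d₂) {L : ℕ} (hL : 1 ≤ L)
    {N : ℕ → ℕ} (hN : ∀ ℓ, 1 ≤ N ℓ) (M : ℕ → ℕ) (h : ℕ → ℝ)
    {τ : ℕ → ScrambleIndex d₁ → Ω → ZMod 2} {ρ : ScrambleIndex d₂ → Ω → ZMod 2}
    (hbits : IsUniformBits P (Sum.elim (fun i : Fin (L + 1) × ScrambleIndex d₁ => τ i.1 i.2) ρ))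
    {f : ℝ → ℝ} (hf : Measurable f) {gh : ℝ → (Fin d₁ → ℝ) → (Fin d₂ → ℝ) → ℝ}
    (hgh : Measurable (Function.uncurry (gh (h L))))
    (hint : ∀ ℓ < L, IntegrableOn (fun y => f (mean (M ℓ) (gh (h ℓ) y) S₂.point)) (unitCube d₁))
    (hintL : Integrable
      (fun z : (Fin d₁ → ℝ) × Ω =>
        f (mean (M L) (gh (h L) z.1) (S₂.scrambledPoint fun i => ρ i z.2)))
      ((volume.restrict (unitCube d₁)).prod P)) :
    ∫ ω, mldlEstimator f gh L N M h (fun ℓ => S₁.scrambledPoint fun i => τ ℓ i ω) S₂.point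
        (S₂.scrambledPoint fun i => ρ i ω) ∂P
      = ∫ z : (Fin d₁ → ℝ) × Ω,
          f (mean (M L) (gh (h L) z.1) (S₂.scrambledPoint fun i => ρ i z.2))
            ∂((volume.restrict (unitCube d₁)).prod P) := by
  let φ : ℕ → (Fin d₁ → ℝ) → ℝ := fun ℓ y => f (mean (M ℓ) (gh (h ℓ) y) S₂.point)
  let a : ℕ → ℝ := fun ℓ => ∫ y in unitCube d₁, φ ℓ y
  let Ψ : (Fin d₁ → ℝ) × (ScrambleIndex d₂ → ZMod 2) → ℝ := fun z =>
    f (mean (M L) (gh (h L) z.1) (S₂.scrambledPoint z.2))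
  have hφ : ∀ ℓ < L, IntegrableOn (φ ℓ) (unitCube d₁) := hint
  have hΨ : Measurable Ψ := measurable_comp_mean_scrambledPoint S₂ hf hgh (M L)
  have hτ : ∀ ℓ ≤ L, IsUniformBits P (τ ℓ) := fun ℓ hℓ =>
    hbits.precomp (e := fun i => Sum.inl (⟨ℓ, by omega⟩, i)) fun i j hij => by simpa using hij
  have hτρ : IsUniformBits P (Sum.elim (τ L) ρ) := by
    have := hbits.precomp (e := Sum.map (fun i => ((⟨L, by omega⟩ : Fin (L + 1)), i)) id)
      (Sum.map_injective.2 ⟨fun i j hij => by simpa using hij, Function.injective_id⟩)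
    convert this using 2 with i
    rcases i with i | i <;> rfl
  have hρm : Measurable fun ω i => ρ i ω := measurable_pi_lambda _ fun i => hbits.1 (Sum.inr i)
  have hym : ∀ n, Measurable fun ω =>
      (S₁.scrambledPoint (fun i => τ L i ω) n, fun i => ρ i ω) := fun n =>
    (S₁.measurable_scrambledPoint_comp (hτ L le_rfl) n).prodMk hρm
  have hzm : Measurable fun z : (Fin d₁ → ℝ) × Ω => (z.1, fun i => ρ i z.2) :=
    measurable_fst.prodMk (hρm.comp measurable_snd)
  have hΨn : ∀ n, Integrable (fun ω => Ψ (S₁.scrambledPoint (fun i => τ L i ω) n,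
      fun i => ρ i ω)) P := by
    intro n
    have h1 : Integrable Ψ (((volume.restrict (unitCube d₁)).prod P).map
        fun z => (z.1, fun i => ρ i z.2)) :=
      (integrable_map_measure hΨ.aestronglyMeasurable hzm.aemeasurable).2 hintL
    rw [← map_scrambledPoint_prodMk S₁ hτρ n] at h1
    exact h1.comp_measurable (hym n)
  have hΨi : ∀ n, ∫ ω, Ψ (S₁.scrambledPoint (fun i => τ L i ω) n, fun i => ρ i ω) ∂P
      = ∫ z : (Fin d₁ → ℝ) × Ω, Ψ (z.1, fun i => ρ i z.2)
          ∂((volume.restrict (unitCube d₁)).prod P) := by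
    intro n
    rw [← integral_map (hym n).aemeasurable hΨ.aestronglyMeasurable,
      map_scrambledPoint_prodMk S₁ hτρ n, integral_map hzm.aemeasurable hΨ.aestronglyMeasurable]
  have hdiff : ∀ ℓ ∈ Finset.Ico 1 L, IntegrableOn (fun y => φ ℓ y - φ (ℓ - 1) y) (unitCube d₁) :=
    fun ℓ hℓ => (hφ ℓ (Finset.mem_Ico.1 hℓ).2).sub
      (hφ (ℓ - 1) (by have := Finset.mem_Ico.1 hℓ; omega))
  have hlast : ∀ ω, mean (N L) (fun y => f (mean (M L) (gh (h L) y)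
        (S₂.scrambledPoint fun i => ρ i ω)) - φ (L - 1) y) (S₁.scrambledPoint fun i => τ L i ω)
      = (∑ n ∈ Finset.range (N L), Ψ (S₁.scrambledPoint (fun i => τ L i ω) n, fun i => ρ i ω)) / N L
        - mean (N L) (φ (L - 1)) (S₁.scrambledPoint fun i => τ L i ω) := by
    intro ω
    rw [mean, mean, Finset.sum_sub_distrib, sub_div]
  have hi0 := S₁.integrable_mean_scrambledPoint (hτ 0 (Nat.zero_le _)) (N 0) (hφ 0 (by omega))
  have hi1 : ∀ ℓ ∈ Finset.Ico 1 L, Integrable (fun ω => mean (N ℓ)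
      (fun y => φ ℓ y - φ (ℓ - 1) y) (S₁.scrambledPoint fun i => τ ℓ i ω)) P := fun ℓ hℓ =>
    S₁.integrable_mean_scrambledPoint (hτ ℓ (Finset.mem_Ico.1 hℓ).2.le) (N ℓ) (hdiff ℓ hℓ)
  have hi2 : Integrable (fun ω => (∑ n ∈ Finset.range (N L),
      Ψ (S₁.scrambledPoint (fun i => τ L i ω) n, fun i => ρ i ω)) / N L) P :=
    (integrable_finsetSum _ fun n _ => hΨn n).div_const _
  have hi3 := S₁.integrable_mean_scrambledPoint (hτ L le_rfl) (N L) (hφ (L - 1) (by omega))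
  have hsum : Integrable (fun ω => ∑ ℓ ∈ Finset.Ico 1 L, mean (N ℓ)
      (fun y => φ ℓ y - φ (ℓ - 1) y) (S₁.scrambledPoint fun i => τ ℓ i ω)) P :=
    integrable_finsetSum _ hi1
  have e1 : ∀ ω, mldlEstimator f gh L N M h (fun ℓ => S₁.scrambledPoint fun i => τ ℓ i ω) S₂.point
        (S₂.scrambledPoint fun i => ρ i ω)
      = mean (N 0) (φ 0) (S₁.scrambledPoint fun i => τ 0 i ω)
        + ∑ ℓ ∈ Finset.Ico 1 L, mean (N ℓ) (fun y => φ ℓ y - φ (ℓ - 1) y)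
            (S₁.scrambledPoint fun i => τ ℓ i ω)
        + ((∑ n ∈ Finset.range (N L),
              Ψ (S₁.scrambledPoint (fun i => τ L i ω) n, fun i => ρ i ω)) / N L
          - mean (N L) (φ (L - 1)) (S₁.scrambledPoint fun i => τ L i ω)) := by
    intro ω
    rw [← hlast]
    rfl
  simp only [e1]
  have hs : ∑ ℓ ∈ Finset.Ico 1 L, ∫ ω, mean (N ℓ) (fun y => φ ℓ y - φ (ℓ - 1) y)
      (S₁.scrambledPoint fun i => τ ℓ i ω) ∂P = a (L - 1) - a 0 := by
    rw [← sum_Ico_one_sub_pred a hL]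
    refine Finset.sum_congr rfl fun ℓ hℓ => ?_
    rw [S₁.integral_mean_scrambledPoint (hτ ℓ (Finset.mem_Ico.1 hℓ).2.le) (hN ℓ) (hdiff ℓ hℓ)]
    exact integral_sub (hφ ℓ (Finset.mem_Ico.1 hℓ).2)
      (hφ (ℓ - 1) (by have := Finset.mem_Ico.1 hℓ; omega))
  have hi01 : Integrable (fun ω => mean (N 0) (φ 0) (S₁.scrambledPoint fun i => τ 0 i ω)
      + ∑ ℓ ∈ Finset.Ico 1 L, mean (N ℓ) (fun y => φ ℓ y - φ (ℓ - 1) y)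
        (S₁.scrambledPoint fun i => τ ℓ i ω)) P := hi0.add hsum
  have hi23 : Integrable (fun ω => (∑ n ∈ Finset.range (N L),
      Ψ (S₁.scrambledPoint (fun i => τ L i ω) n, fun i => ρ i ω)) / N L
      - mean (N L) (φ (L - 1)) (S₁.scrambledPoint fun i => τ L i ω)) P := hi2.sub hi3
  have hNL : (N L : ℝ) ≠ 0 := by
    have := hN L
    exact_mod_cast (by omega : N L ≠ 0)
  rw [integral_add hi01 hi23, integral_add hi0 hsum, integral_sub hi2 hi3,
    integral_finsetSum _ hi1, hs, integral_div, integral_finsetSum _ fun n _ => hΨn n,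
    Finset.sum_congr rfl fun n _ => hΨi n,
    S₁.integral_mean_scrambledPoint (hτ 0 (Nat.zero_le _)) (hN 0) (hφ 0 (by omega)),
    S₁.integral_mean_scrambledPoint (hτ L le_rfl) (hN L) (hφ (L - 1) (by omega)),
    Finset.sum_const, Finset.card_range, nsmul_eq_mul, mul_div_cancel_left₀ _ hNL]
  simp only [a, φ, Ψ]
  ring

end

/-! ### The bias bound -/

/-- The inverse inequality between `g (y, ·)` and `ḡ y`, as a pointwise bound of the variation. -/
lemma hardyKrause_le_of_iSup_lt {d₁ d₂ : ℕ} {g : (Fin d₁ → ℝ) → (Fin d₂ → ℝ) → ℝ}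
    (hne : ∀ y ∈ unitCube d₁, innerIntegral g y ≠ 0) {k : ℝ} (hk : 0 < k)
    (h : (⨆ y ∈ unitCube d₁, hardyKrause (g y) / ENNReal.ofReal |innerIntegral g y|)
      < ENNReal.ofReal k) {y : Fin d₁ → ℝ} (hy : y ∈ unitCube d₁) :
    hardyKrause (g y) ≤ ENNReal.ofReal (k * |innerIntegral g y|) := by
  have h1 := (le_iSup₂ (f := fun y (_ : y ∈ unitCube d₁) =>
    hardyKrause (g y) / ENNReal.ofReal |innerIntegral g y|) y hy).trans h.le
  rw [ENNReal.ofReal_mul hk.le]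
  refine (ENNReal.div_le_iff ?_ ENNReal.ofReal_ne_top).1 h1
  exact (ENNReal.ofReal_pos.2 (abs_pos.2 (hne y hy))).ne'

end MLDLQMC

theorem mainTheorem5 (d₁ d₂ : ℕ) (hd₁ : 0 < d₁) (hd₂ : 0 < d₂) (S₂ : SobolSequence d₂) :
    -- the constants of the discrepancy bounds depend only on `ε` and the inner Sobol' sequence
    ∃ C : ℝ → ℝ,
      Tendsto C (𝓝[>] 0) atTop ∧
      (∀ ε > 0, 0 < C ε) ∧
      (∀ ε > 0, ∀ M : ℕ, 1 ≤ M → starDiscrepancy M S₂.point ≤ C ε / (M : ℝ) ^ (1 - ε)) ∧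
      (∀ (Ω : Type*) [MeasurableSpace Ω] (P : Measure Ω) [IsProbabilityMeasure P]
        (ρ : ScrambleIndex d₂ → Ω → ZMod 2), IsUniformBits P ρ →
        ∀ ε > 0, ∀ᵐ ω ∂P, ∀ M : ℕ, 1 ≤ M →
          starDiscrepancy M (S₂.scrambledPoint fun i => ρ i ω) ≤ C ε / (M : ℝ) ^ (1 - ε)) ∧
      -- the bias bound
      ∀ (S₁ : SobolSequence d₁)
        (L : ℕ) (_ : 1 ≤ L) (N M : ℕ → ℕ) (h : ℕ → ℝ)
        (_ : ∀ ℓ, 1 ≤ N ℓ) (_ : ∀ ℓ, 1 ≤ M ℓ) (_ : ∀ ℓ, 0 < h ℓ)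
        -- independent scramblings: `τ ℓ` of the outer points at level `ℓ`, `ρ` of the inner points
        (Ω : Type*) [MeasurableSpace Ω] (P : Measure Ω) [IsProbabilityMeasure P]
        (τ : ℕ → ScrambleIndex d₁ → Ω → ZMod 2) (ρ : ScrambleIndex d₂ → Ω → ZMod 2)
        (_ : IsUniformBits P
          (Sum.elim (fun i : Fin (L + 1) × ScrambleIndex d₁ => τ i.1 i.2) ρ))
        -- the integrands
        (f : ℝ → ℝ) (U : Set ℝ) (g : (Fin d₁ → ℝ) → (Fin d₂ → ℝ) → ℝ)
        (gh : ℝ → (Fin d₁ → ℝ) → (Fin d₂ → ℝ) → ℝ)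
        (_ : Measurable f) (_ : Measurable (Function.uncurry g))
        (_ : ∀ ℓ ≤ L, Measurable (Function.uncurry (gh (h ℓ))))
        (_ : IsOpen U) (_ : ContDiffOn ℝ 3 f U)
        (_ : MonotoneOn (fun z => |iteratedDeriv 3 f z|) U ∨
          AntitoneOn (fun z => |iteratedDeriv 3 f z|) U)
        (_ : (∀ y ∈ unitCube d₁, 0 < innerIntegral g y) ∨
          (∀ y ∈ unitCube d₁, innerIntegral g y < 0))
        (_ : ∀ K ∈ Set.Ioo (0 : ℝ) 2, ∀ y ∈ unitCube d₁, K * innerIntegral g y ∈ U)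
        -- the evaluations of `f` entering the estimator have finite expectations
        (_ : ∀ ℓ < L, IntegrableOn
          (fun y => f (mean (M ℓ) (gh (h ℓ) y) S₂.point)) (unitCube d₁))
        (_ : Integrable
          (fun z : (Fin d₁ → ℝ) × Ω =>
            f (mean (M L) (gh (h L) z.1) (S₂.scrambledPoint fun i => ρ i z.2)))
          ((volume.restrict (unitCube d₁)).prod P))
        -- weak rate of the approximation at level `L`
        (Cw ηw : ℝ) (_ : 0 < Cw) (_ : 0 < ηw)
        (_ : HasWeakRate P f g (gh (h L)) (M L)
          (fun ω => S₂.scrambledPoint fun i => ρ i ω) (h L) Cw ηw)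
        -- Sobolev assumption
        (p q : ℝ≥0∞) (_ : 1 ≤ p) (_ : 1 ≤ q) (_ : 1 / p + 1 / q = 1)
        (_ : ∀ K ∈ Set.Ioo (0 : ℝ) 2, MemSobolev 3 p (fun y => f (K * innerIntegral g y)))
        -- inverse inequality
        (k : ℝ) (_ : 0 < k)
        (_ : (⨆ y ∈ unitCube d₁,
          hardyKrause (g y) / ENNReal.ofReal |innerIntegral g y|) < ENNReal.ofReal k)
        (_ : MemLp (innerIntegral g) (3 * q) (volume.restrict (unitCube d₁)))
        (ε : ℝ) (_ : 0 < ε) (_ : k * C ε / (M L : ℝ) ^ (1 - ε) < 1),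
        ∃ K : ℝ, 0 < K ∧ K < 2 ∧
          ENNReal.ofReal
              |(∫ ω, mldlEstimator f gh L N M h
                  (fun ℓ => S₁.scrambledPoint fun i => τ ℓ i ω)
                  S₂.point
                  (S₂.scrambledPoint fun i => ρ i ω) ∂P) - nestedIntegral f g|
            ≤ ENNReal.ofReal (Cw * h L ^ ηw)
              + derivMoment f g 2 1
                * ENNReal.ofReal (k ^ (2:ℕ) * C ε ^ (2:ℕ) / (2 * (M L : ℝ) ^ (2 - 2 * ε)))
              + derivMoment f g 3 K
                * ENNReal.ofReal (k ^ (3:ℕ) * C ε ^ (3:ℕ) / (6 * (M L : ℝ) ^ (3 - 3 * ε))) := by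
  -- the discrepancy bound holds for every scrambling, not only almost surely
  refine ⟨S₂.discConst, S₂.tendsto_discConst, fun ε hε => S₂.discConst_pos hε,
    fun ε hε M hM => ?_, fun Ω _ P _ ρ _ ε hε => Eventually.of_forall fun ω M hM =>
      S₂.starDiscrepancy_scrambledPoint_le_discConst _ hε hM, ?_⟩
  · rw [S₂.point_eq_scrambledPoint_zero]
    exact S₂.starDiscrepancy_scrambledPoint_le_discConst _ hε hM
  intro S₁ L hL N M h hN hM hh Ω _ P _ τ ρ hbits f U g gh hf hg hgh hU hfU hmono hsign hKU hint
    hintL Cw ηw _ _ hweak p q hp _ _ hsob k hk hHK _ ε hε hθ1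
  have hρ : IsUniformBits P ρ := hbits.precomp (e := Sum.inr) Sum.inr_injective
  have hne : ∀ y ∈ unitCube d₁, innerIntegral g y ≠ 0 := fun y hy => by
    rcases hsign with hs | hs
    · exact (hs y hy).ne'
    · exact (hs y hy).ne
  have hfg : IntegrableOn (fun y => f (innerIntegral g y)) (unitCube d₁) := by
    simpa only [one_mul] using integrableOn_of_memSobolev hp (hsob 1 ⟨one_pos, one_lt_two⟩)
  have hMpos : (0 : ℝ) < M L := by exact_mod_cast hM L
  set θ : ℝ := k * S₂.discConst ε / (M L : ℝ) ^ (1 - ε) with hθ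
  have hC := S₂.discConst_pos hε
  have hθ0 : 0 < θ := by positivity
  have hθM : k * (2 * S₂.discBound (M L)) ≤ θ := by
    rw [hθ, mul_div_assoc]
    exact mul_le_mul_of_nonneg_left (S₂.two_mul_discBound_le hε (hM L)) hk.le
  -- the integrand with the exact `g` differs from the approximate one by an integrable function
  have hintg : Integrable (fun z : (Fin d₁ → ℝ) × Ω =>
        f (mean (M L) (g z.1) (S₂.scrambledPoint fun i => ρ i z.2)))
      ((volume.restrict (unitCube d₁)).prod P) :=
    (hintL.sub hweak.1).congr (Eventually.of_forall fun z => by simp)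
  obtain ⟨K, hK0, hK2, hK⟩ := exists_ofReal_abs_integral_comp_mean_sub_le S₂ hρ hg hU hfU hmono
    hsign hKU (hM L) hintg hfg hk (fun y hy => hardyKrause_le_of_iSup_lt hne hk hHK hy) hθ0 hθ1
    hθM
  refine ⟨K, hK0, hK2, ?_⟩
  have e2 : k ^ (2 : ℕ) * S₂.discConst ε ^ (2 : ℕ) / (2 * (M L : ℝ) ^ (2 - 2 * ε)) = θ ^ 2 / 2 := by
    have : (M L : ℝ) ^ (2 - 2 * ε) = ((M L : ℝ) ^ (1 - ε)) ^ 2 := by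
      rw [← Real.rpow_mul_natCast hMpos.le]
      congr 1
      push_cast
      ring
    rw [this, hθ]
    field_simp
  have e3 : k ^ (3 : ℕ) * S₂.discConst ε ^ (3 : ℕ) / (6 * (M L : ℝ) ^ (3 - 3 * ε)) = θ ^ 3 / 6 := by
    have : (M L : ℝ) ^ (3 - 3 * ε) = ((M L : ℝ) ^ (1 - ε)) ^ 3 := by
      rw [← Real.rpow_mul_natCast hMpos.le]
      congr 1
      push_cast
      ring
    rw [this, hθ]
    field_simp
  rw [e2, e3, integral_mldlEstimator S₁ S₂ hL hN M h hbits hf (hgh L le_rfl) hint hintL, add_assoc]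
  have hw := hweak.2
  rw [integral_sub hintL hintg] at hw
  rw [← sub_add_sub_cancel _ (∫ z : (Fin d₁ → ℝ) × Ω,
    f (mean (M L) (g z.1) (S₂.scrambledPoint fun i => ρ i z.2))
      ∂((volume.restrict (unitCube d₁)).prod P))]
  refine (ENNReal.ofReal_le_ofReal (abs_add_le _ _)).trans ?_
  rw [ENNReal.ofReal_add (abs_nonneg _) (abs_nonneg _)]
  exact add_le_add (ENNReal.ofReal_le_ofReal hw) hK
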